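/- Let $q\colon E\to M$ be a smooth real vector bundle of finite rank over a smooth (finite-dimensional, Hausdorff, boundaryless) manifold, let $X$ be a smooth vector field on $M$, and let $D\colon\Gamma(E)\to\Gamma(E)$ be a linear derivation of $E$ with symbol $X$, that is, an $\mathbb R$-linear map with $D(fe)=X(f)\,e+f\,De$ for all $f\in C^\infty(M)$ and $e\in\Gamma(E)$. Let $\widehat D$ be the linear vector field on $E$ attached to $D$, i.e. the vector field with $$\widehat D(e(m))=T_me(X(m))+\left.\tfrac{d}{dt}\right|_{t=0}\bigl(e(m)-t\,(De)(m)\bigr)\qquad(m\in M,\ e\in\Gamma(E));$$ equivalently $\widehat D(q^*f)=q^*(X(f))$ and $\widehat D(\ell_\varepsilon)=\ell_{D^*\varepsilon}$ for all $f\in C^\infty(M)$ and $\varepsilon\in\Gamma(E^*)$, where $\ell_\varepsilon\colon E\to\mathbb R$ is the fibrewise linear function $e_m\mapsto\langle\varepsilon(m),e_m\rangle$ and $\langle D^*\varepsilon,e\rangle=X\langle\varepsilon,e\rangle-\langle\varepsilon,De\rangle$. Let $\phi\colon\Omega\to M$, $\Omega\subseteq\mathbb R\times M$, be the maximal flow of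 $X$, let $\Phi$ be the maximal flow of $\widehat D$, and for $t\in\mathbb R$ put $M_t=\{x\in M\mid (t,x)\in\Omega\}$. Then for every $t\in\mathbb R$ the set $M_t$ is open, and for every $e\in\Gamma(E)$ the formula $$(\Phi_t^\star e)_x=\Phi_{-t}\bigl(e(\phi_t(x))\bigr)\in E_x,\qquad x\in M_t,$$ is well defined and gives a smooth section $\Phi_t^\star e\in\Gamma_{M_t}(E)$ of $E$ over $M_t$. For every $e\in\Gamma(E)$, $$De=\left.\frac{d}{dt}\right|_{t=0}\Phi_t^\star e,$$ where the derivative exists and is taken pointwise, i.e. in the fibers of $E$. In particular, for every $e\in\Gamma(E)$, one has $\Phi_t^\star e=e$ on $M_t$ for all $t\in\mathbb R$ if and only if $De=0$. -/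

import Mathlib

open Set Filter Topology Bundle Manifold
open scoped ContDiff

noncomputable section

namespace BundleFlow

section Flow

variable {E : Type*} [NormedAddCommGroup E] [NormedSpace ℝ E]
  {H : Type*} [TopologicalSpace H] {J : ModelWithCorners ℝ E H}
  {N : Type*} [TopologicalSpace N] [ChartedSpace H N]

/-- `γ` is an integral curve of the vector field `W`, defined on some open interval containing
`0` and `t`, with `γ 0 = x`. -/
def ReachesFrom (W : (y : N) → TangentSpace J y) (t : ℝ) (x : N) (γ : ℝ → N) : Prop :=
  γ 0 = x ∧ ∃ a b : ℝ, 0 ∈ Ioo a b ∧ t ∈ Ioo a b ∧ IsMIntegralCurveOn γ W (Ioo a b)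

/-- The (maximal) flow domain of `W`: all `(t, x)` such that the maximal integral curve of `W`
through `x` at time `0` is defined at time `t`. -/
def flowDomain (W : (y : N) → TangentSpace J y) : Set (ℝ × N) :=
  {p | ∃ γ : ℝ → N, ReachesFrom W p.1 p.2 γ}

open Classical in
/-- The (maximal) flow of `W`: `flow W t x` is the value at time `t` of the integral curve of `W`
through `x` at time `0`.  It is meaningful for `(t, x) ∈ flowDomain W`; off the flow domain it
has the irrelevant value `x`. -/
def flow (W : (y : N) → TangentSpace J y) (t : ℝ) (x : N) : N :=
  if h : ∃ γ : ℝ → N, ReachesFrom W t x γ then h.choose t else x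

/-- The set `M_t` of all points at which the time-`t` flow of `W` is defined. -/
def timeDomain (W : (y : N) → TangentSpace J y) (t : ℝ) : Set N :=
  {x | (t, x) ∈ flowDomain W}

end Flow

variable {EM : Type*} [NormedAddCommGroup EM] [NormedSpace ℝ EM]
  {H : Type*} [TopologicalSpace H] {I : ModelWithCorners ℝ EM H}
  {M : Type*} [TopologicalSpace M] [ChartedSpace H M]
  {F : Type*} [NormedAddCommGroup F] [NormedSpace ℝ F]
  {V : M → Type*} [TopologicalSpace (TotalSpace F V)] [∀ x, TopologicalSpace (V x)]
  [FiberBundle F V] [∀ x, AddCommGroup (V x)] [∀ x, Module ℝ (V x)] [VectorBundle ℝ F V]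

/-- The derivative `(u f)(x)` of a real function `f` in the direction of a tangent vector `u`
at `x`. -/
def dirDeriv (I : ModelWithCorners ℝ EM H) (f : M → ℝ) (x : M) (u : TangentSpace I x) : ℝ :=
  mfderiv I 𝓘(ℝ) f x u

/-- The product `f e` of a smooth function and a smooth section. -/
def smulSection (f : C^∞⟮I, M; 𝓘(ℝ), ℝ⟯) (e : Cₛ^∞⟮I; F, V⟯) : Cₛ^∞⟮I; F, V⟯ :=
  ⟨(f : M → ℝ) • (e : ∀ x, V x), f.contMDiff.smul_section e.contMDiff⟩

/-- The product is taken pointwise. -/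
theorem smulSection_apply (f : C^∞⟮I, M; 𝓘(ℝ), ℝ⟯) (e : Cₛ^∞⟮I; F, V⟯) (x : M) :
    smulSection f e x = f x • e x := rfl

variable (F V) in
/-- A linear derivation of the vector bundle `V` with symbol the smooth vector field `X`: an
`ℝ`-linear map `D : Γ(V) → Γ(V)` with `D (f e) = X(f) e + f D e` for all smooth `f` and `e`. -/
structure LinearDerivation [IsManifold I ∞ M] (X : Cₛ^∞⟮I; EM, (TangentSpace I : M → Type _)⟯)
    extends Cₛ^∞⟮I; F, V⟯ →ₗ[ℝ] Cₛ^∞⟮I; F, V⟯ where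
  leibniz : ∀ (f : C^∞⟮I, M; 𝓘(ℝ), ℝ⟯) (e : Cₛ^∞⟮I; F, V⟯) (x : M),
    toFun (smulSection f e) x = dirDeriv I f x (X x) • e x + f x • toFun e x

/-- Every vector of a smooth vector bundle is the value of a smooth global section. -/
theorem exists_section [FiniteDimensional ℝ EM] [T2Space M] [IsManifold I ∞ M]
    [ContMDiffVectorBundle ∞ F V I] (v : TotalSpace F V) :
    ∃ e : Cₛ^∞⟮I; F, V⟯, e v.1 = v.2 := by
  obtain ⟨s, hs, hsm⟩ := FiberBundle.exists_contMDiffOn_extend (k := ∞) I F v.2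
  obtain ⟨u, hus, hu, hvu⟩ := mem_nhds_iff.1 hs
  obtain ⟨f, hf, -⟩ := (SmoothBumpFunction.nhds_basis_support (I := I) (hu.mem_nhds hvu)).mem_iff.1
    (hu.mem_nhds hvu)
  have h := ContMDiffOn.smul_section_of_tsupport (f.contMDiff.contMDiffOn) hu hf (hsm.mono hus)
  refine ⟨⟨_, h⟩, ?_⟩
  show f v.1 • FiberBundle.extend F v.2 v.1 = v.2
  rw [f.eq_one, one_smul]
  simp

/-- The vertical curve `t ↦ w - t u` in the fibre over `x`, as a curve in the total space. -/
def verticalCurve (F : Type*) {V : M → Type*} [∀ x, AddCommGroup (V x)] [∀ x, Module ℝ (V x)]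
    (x : M) (w u : V x) (t : ℝ) : TotalSpace F V :=
  ⟨x, w - t • u⟩

/-- The linear vector field `D̂` on the total space attached to a derivation `D` with symbol `X`:
`D̂ (e(m)) = T_m e (X(m)) + d/dt|_{t=0} (e(m) - t (D e)(m))`, where `e` is any smooth section with
the given value at `m`; by the Leibniz rule the right hand side depends on `e(m)` only. -/
def hat [FiniteDimensional ℝ EM] [T2Space M] [IsManifold I ∞ M] [ContMDiffVectorBundle ∞ F V I]
    {X : Cₛ^∞⟮I; EM, (TangentSpace I : M → Type _)⟯} (D : LinearDerivation F V X)
    (v : TotalSpace F V) : TangentSpace (I.prod 𝓘(ℝ, F)) v :=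
  let e : Cₛ^∞⟮I; F, V⟯ := (exists_section v).choose
  let horizontal : TangentSpace (I.prod 𝓘(ℝ, F)) v :=
    mfderiv I (I.prod 𝓘(ℝ, F)) (fun x ↦ TotalSpace.mk' F x (e x)) v.1 (X v.1)
  let vertical : TangentSpace (I.prod 𝓘(ℝ, F)) v :=
    mfderiv 𝓘(ℝ) (I.prod 𝓘(ℝ, F)) (verticalCurve F v.1 (e v.1) (D.toLinearMap e v.1)) 0 (1 : ℝ)
  horizontal + vertical

theorem contMDiff_verticalCurve [IsManifold I ∞ M] [ContMDiffVectorBundle ∞ F V I]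
    (x : M) (w u : V x) :
    ContMDiff 𝓘(ℝ) (I.prod 𝓘(ℝ, F)) ∞ (verticalCurve F x w u) := by
  intro t
  rw [contMDiffAt_totalSpace]
  refine ⟨contMDiffAt_const, ?_⟩
  have hx := mem_baseSet_trivializationAt F V x
  have : (fun s : ℝ ↦ (trivializationAt F V (verticalCurve F x w u t).1
      (verticalCurve F x w u s)).2) =
      fun s ↦ (trivializationAt F V x).linearMapAt ℝ x w
        - s • (trivializationAt F V x).linearMapAt ℝ x u := by
    funext s
    rw [← map_smul, ← map_sub, Trivialization.coe_linearMapAt_of_mem _ hx]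
    rfl
  rw [this]
  exact (contDiff_const.sub (contDiff_id.smul contDiff_const)).contMDiff.contMDiffAt

/-- The chain rule for the sum defining `hat`, evaluated on a smooth function `g`. -/
theorem dirDeriv_hat [FiniteDimensional ℝ EM] [T2Space M] [IsManifold I ∞ M]
    [ContMDiffVectorBundle ∞ F V I]
    {X : Cₛ^∞⟮I; EM, (TangentSpace I : M → Type _)⟯} (D : LinearDerivation F V X)
    (v : TotalSpace F V) (g : TotalSpace F V → ℝ)
    (hg : ContMDiff (I.prod 𝓘(ℝ, F)) 𝓘(ℝ) ∞ g) :
    ∃ e : Cₛ^∞⟮I; F, V⟯, e v.1 = v.2 ∧ dirDeriv (I.prod 𝓘(ℝ, F)) g v (hat D v) =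
      dirDeriv I (fun x ↦ g (TotalSpace.mk' F x (e x))) v.1 (X v.1) +
        deriv (fun t ↦ g (verticalCurve F v.1 (e v.1) (D.toLinearMap e v.1) t)) 0 := by
  set e : Cₛ^∞⟮I; F, V⟯ := (exists_section v).choose with he
  have hev : e v.1 = v.2 := (exists_section (I := I) v).choose_spec
  have hv : TotalSpace.mk' F v.1 (e v.1) = v := by rw [hev]
  have hv' : verticalCurve F v.1 (e v.1) (D.toLinearMap e v.1) 0 = v := by
    simp [verticalCurve, hev]
  refine ⟨e, hev, ?_⟩
  have hgv : MDifferentiableAt (I.prod 𝓘(ℝ, F)) 𝓘(ℝ) g v := hg.mdifferentiableAt (by simp)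
  have hs : MDifferentiableAt I (I.prod 𝓘(ℝ, F)) (fun x ↦ TotalSpace.mk' F x (e x)) v.1 :=
    e.mdifferentiableAt
  have hc : MDifferentiableAt 𝓘(ℝ) (I.prod 𝓘(ℝ, F))
      (verticalCurve F v.1 (e v.1) (D.toLinearMap e v.1)) 0 :=
    (contMDiff_verticalCurve (I := I) v.1 _ _).mdifferentiableAt (by simp)
  have h1 := HasMFDerivAt.comp v.1 (hv.symm ▸ hgv).hasMFDerivAt hs.hasMFDerivAt
  have h2 := HasMFDerivAt.comp (0 : ℝ) (hv'.symm ▸ hgv).hasMFDerivAt hc.hasMFDerivAt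
  have key : ∀ (p : TotalSpace F V) (_ : p = v) (a : EM × F),
      (mfderiv (I.prod 𝓘(ℝ, F)) 𝓘(ℝ) g p : EM × F → ℝ) a =
        (mfderiv (I.prod 𝓘(ℝ, F)) 𝓘(ℝ) g v : EM × F → ℝ) a := by
    rintro p rfl a; rfl
  have e1 : dirDeriv I (fun x ↦ g (TotalSpace.mk' F x (e x))) v.1 (X v.1) = _ :=
    (congrArg (fun A : EM →L[ℝ] ℝ ↦ A (X v.1)) h1.mfderiv).trans (key _ hv _)
  have e2 : deriv (fun t ↦ g (verticalCurve F v.1 (e v.1) (D.toLinearMap e v.1) t)) 0 = _ :=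
    (congrArg (fun A : ℝ →L[ℝ] ℝ ↦ A 1) (mfderiv_eq_fderiv.symm.trans h2.mfderiv)).trans
      (key _ hv' _)
  rw [e1, e2]
  exact map_add (mfderiv (I.prod 𝓘(ℝ, F)) 𝓘(ℝ) g v) _ _

/-- `D̂` acts on pullback functions by `D̂ (q^* f) = q^* (X f)`. -/
theorem hat_pullback [FiniteDimensional ℝ EM] [T2Space M] [IsManifold I ∞ M]
    [ContMDiffVectorBundle ∞ F V I]
    {X : Cₛ^∞⟮I; EM, (TangentSpace I : M → Type _)⟯} (D : LinearDerivation F V X)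
    (f : C^∞⟮I, M; 𝓘(ℝ), ℝ⟯) (v : TotalSpace F V) :
    dirDeriv (I.prod 𝓘(ℝ, F)) (fun w : TotalSpace F V ↦ f w.1) v (hat D v) =
      dirDeriv I f v.1 (X v.1) := by
  obtain ⟨e, -, h⟩ := dirDeriv_hat D v (fun w : TotalSpace F V ↦ f w.1)
    (f.contMDiff.comp (contMDiff_proj V))
  simpa [verticalCurve] using h

/-- `D̂` acts on fibrewise linear functions by `D̂ (ℓ_ε) = ℓ_{D^* ε}`, where
`⟨D^* ε, e⟩ = X ⟨ε, e⟩ - ⟨ε, D e⟩`. Here `l` is `ℓ_ε` and `l'` is `ℓ_{D^* ε}`. -/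
theorem hat_linear [FiniteDimensional ℝ EM] [T2Space M] [IsManifold I ∞ M]
    [ContMDiffVectorBundle ∞ F V I]
    {X : Cₛ^∞⟮I; EM, (TangentSpace I : M → Type _)⟯} (D : LinearDerivation F V X)
    (ε ε' : ∀ x, V x →ₗ[ℝ] ℝ)
    (hε : ContMDiff (I.prod 𝓘(ℝ, F)) 𝓘(ℝ) ∞ (fun w : TotalSpace F V ↦ ε w.1 w.2))
    (hD : ∀ (e : Cₛ^∞⟮I; F, V⟯) (x : M), ε' x (e x) =
      dirDeriv I (fun y ↦ ε y (e y)) x (X x) - ε x (D.toLinearMap e x))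
    (v : TotalSpace F V) :
    dirDeriv (I.prod 𝓘(ℝ, F)) (fun w : TotalSpace F V ↦ ε w.1 w.2) v (hat D v) =
      ε' v.1 v.2 := by
  obtain ⟨e, he, h⟩ := dirDeriv_hat D v (fun w : TotalSpace F V ↦ ε w.1 w.2) hε
  have hd : HasDerivAt (fun t : ℝ ↦ ε v.1 (e v.1 - t • D.toLinearMap e v.1))
      (-(ε v.1 (D.toLinearMap e v.1))) 0 := by
    simp only [map_sub, map_smul, smul_eq_mul]
    simpa using ((hasDerivAt_id (0 : ℝ)).mul_const (ε v.1 (D.toLinearMap e v.1))).const_sub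
      (ε v.1 (e v.1))
  rw [h, ← he, hD e v.1, sub_eq_add_neg, ← hd.deriv]
  rfl

open Classical in
/-- `(Φ_t^⋆ e)_x = Φ_{-t} (e (φ_t x))`, where `φ` is the flow of `X` and `Φ` that of `D̂`.  The
point `Φ_{-t} (e (φ_t x))` of the total space is regarded as an element of the fibre over `x`;
should it not lie over `x` (which happens at most off the domain of `φ_t`) the value is `0`. -/
def pull [FiniteDimensional ℝ EM] [T2Space M] [IsManifold I ∞ M] [ContMDiffVectorBundle ∞ F V I]
    {X : Cₛ^∞⟮I; EM, (TangentSpace I : M → Type _)⟯} (D : LinearDerivation F V X)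
    (t : ℝ) (e : Cₛ^∞⟮I; F, V⟯) (x : M) : V x :=
  if h : (flow (hat D) (-t) (TotalSpace.mk' F (flow X t x) (e (flow X t x)))).1 = x then
    h ▸ (flow (hat D) (-t) (TotalSpace.mk' F (flow X t x) (e (flow X t x)))).2
  else 0

end BundleFlow

end

/-! In a local trivialization `hat D` reads `(X(x), A(x) w)`, with `A(x)` linear in the fibre
coordinate `w` and smooth in `x`: locality of `D` and the Leibniz rule express `D e` through the
coordinates of `e` and the values of `D` on finitely many local frame sections (`fibrePart_eq`).
Hence `hat D` is smooth, independent of the section used to compute it, related to `X` by the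
projection, and related to itself by every fibrewise scaling.

These relations carry over to flows (`flow_map`). The projection shows that `Φ` covers `φ`. Scaling
shows that existence time is uniform on fibres: a vector can be shrunk into a neighbourhood of the
zero section, flowed, and scaled back. So `Φ` exists as long as `φ` does (`mem_flowDomain_hat`), and
the pullback is a composition of smooth maps.

For the derivative, let `C` be the fibre coordinate around `x` and `h (s, t) = C (Φ_s (e (φ_t x)))`.
At the origin the `s`-derivative is the derivative of the coordinate of `e` along `X` minus the
coordinate of `D e`, and the `t`-derivative is that same derivative along `X`. Along `(-t, t)` the
two copies cancel and the coordinate of `D e` remains (`hasDerivAt_fibreCoord_pull`). If `D e = 0`,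
the section `e` itself relates `X` to `hat D` and is therefore invariant; conversely an invariant
section has zero derivative.

All of this rests on openness of the flow domain and smoothness of the flow. Locally they come from
the implicit function theorem for the integral equation in the Banach space of continuous curves,
and the group law spreads them along integral curves (`flow_nhds_nat`). -/

noncomputable section

namespace BundleFlow

/-! ### Superposition operators on spaces of continuous maps -/

section Superposition

variable {K : Type*} [TopologicalSpace K] [CompactSpace K]
  {E G : Type*} [NormedAddCommGroup E] [NormedSpace ℝ E] [NormedAddCommGroup G] [NormedSpace ℝ G]

/-- Pointwise application of a bounded bilinear map, as a bounded bilinear map on continuous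
maps. -/
def pointwiseBilin {A : Type*} [NormedAddCommGroup A] [NormedSpace ℝ A] (B : A →L[ℝ] E →L[ℝ] G) :
    C(K, A) →L[ℝ] C(K, E) →L[ℝ] C(K, G) :=
  LinearMap.mkContinuous₂
    (LinearMap.mk₂ ℝ (fun (α : C(K, A)) (h : C(K, E)) ↦
        (⟨fun k ↦ B (α k) (h k), by fun_prop⟩ : C(K, G)))
      (fun _ _ _ ↦ by ext; simp) (fun _ _ _ ↦ by ext; simp)
      (fun _ _ _ ↦ by ext; simp) (fun _ _ _ ↦ by ext; simp)) ‖B‖ (by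
    intro α h
    refine (ContinuousMap.norm_le _ (by positivity)).2 fun k ↦ ?_
    refine (B.le_opNorm₂ _ _).trans ?_
    gcongr
    · exact α.norm_coe_le_norm k
    · exact h.norm_coe_le_norm k)

theorem contDiff_pointwiseBilin {A X : Type*} [NormedAddCommGroup A] [NormedSpace ℝ A]
    [NormedAddCommGroup X] [NormedSpace ℝ X] (B : A →L[ℝ] E →L[ℝ] G) {n : WithTop ℕ∞}
    {α : X → C(K, A)} (hα : ContDiff ℝ n α) :
    ContDiff ℝ n (fun x ↦ (pointwiseBilin B (α x) : C(K, E) →L[ℝ] C(K, G))) := by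
  have h : ContDiff ℝ n (fun a : C(K, A) ↦ (pointwiseBilin B a : C(K, E) →L[ℝ] C(K, G))) :=
    ContinuousLinearMap.contDiff _
  exact h.comp hα

/-- Pointwise application of a continuous family of continuous linear maps to a continuous map,
as a bounded bilinear map. -/
def pointwiseApply : C(K, E →L[ℝ] G) →L[ℝ] C(K, E) →L[ℝ] C(K, G) :=
  pointwiseBilin (.id ℝ (E →L[ℝ] G))

@[simp]
theorem pointwiseApply_apply (A : C(K, E →L[ℝ] G)) (h : C(K, E)) (k : K) :
    pointwiseApply A h k = A k (h k) := rfl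

/-- The pointwise mean value inequality bounds the error at each `k`; compactness of the range of
`γ` makes the bound uniform in `k`. -/
theorem hasFDerivAt_postcomp (f : C(E, G)) (f' : C(E, E →L[ℝ] G))
    (h : ∀ x, HasFDerivAt f (f' x) x) (γ : C(K, E)) :
    HasFDerivAt (fun γ : C(K, E) ↦ f.comp γ) (pointwiseApply (f'.comp γ)) γ := by
  refine HasFDerivAt.of_isLittleO (Asymptotics.isLittleO_iff.2 fun c hc ↦ ?_)
  -- `E` need not be locally compact, so a neighbourhood of the range may fail to be compact. It
  -- suffices to have uniformity for pairs with only the first point in the range.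
  have hu := (isCompact_range γ.continuous).uniformContinuousAt_of_continuousAt f'
    (fun a _ ↦ f'.continuous.continuousAt) (Metric.dist_mem_uniformity hc)
  obtain ⟨δ, hδ, hδu⟩ := Metric.mem_uniformity_dist.1 hu
  filter_upwards [Metric.ball_mem_nhds γ hδ] with η hη
  refine (ContinuousMap.norm_le _ (by positivity)).2 fun k ↦ ?_
  have hk : η k ∈ Metric.ball (γ k) δ :=
    (ContinuousMap.dist_apply_le_dist k).trans_lt hη
  have := (convex_ball (γ k) δ).norm_image_sub_le_of_norm_hasFDerivWithin_le'
    (f := f) (f' := f') (φ := f' (γ k)) (C := c) (x := γ k) (y := η k)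
    (fun x _ ↦ (h x).hasFDerivWithinAt) (fun x hx ↦ by
      rw [← dist_eq_norm, dist_comm]
      refine le_of_lt (hδu (a := γ k) (b := x) ?_ ⟨k, rfl⟩)
      rwa [dist_comm])
    (Metric.mem_ball_self hδ) hk
  calc _ = ‖f (η k) - f (γ k) - f' (γ k) (η k - γ k)‖ := by simp
    _ ≤ c * ‖η k - γ k‖ := this
    _ ≤ c * ‖η - γ‖ := by gcongr; exact (η - γ).norm_coe_le_norm k

end Superposition

section Superposition

universe u v

variable {K : Type v} [TopologicalSpace K] [CompactSpace K]
  {E : Type u} [NormedAddCommGroup E] [NormedSpace ℝ E]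

/-- The derivative of postcomposition by `f` is again postcomposition, by `f'`, followed by a
bounded linear map, so induction on `n` applies. The target `G` is quantified inside the induction
because it becomes `E →L[ℝ] G`; the common universe of `E` and `G` makes this possible. -/
theorem contDiff_nat_postcomp (n : ℕ) : ∀ {G : Type u} [NormedAddCommGroup G] [NormedSpace ℝ G]
    (f : C(E, G)), ContDiff ℝ n f → ContDiff ℝ n (fun γ : C(K, E) ↦ f.comp γ) := by
  induction n with
  | zero =>
    intro G _ _ f _
    exact contDiff_zero.2 f.continuous_postcomp
  | succ n ih =>
    intro G _ _ f hf
    obtain ⟨f', hf', hd⟩ := contDiff_succ_iff_hasFDerivAt.1 hf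
    refine contDiff_succ_iff_hasFDerivAt.2 ⟨_, ?_,
      hasFDerivAt_postcomp f ⟨f', hf'.continuous⟩ hd⟩
    exact contDiff_pointwiseBilin (.id ℝ (E →L[ℝ] G)) (ih ⟨f', hf'.continuous⟩ hf')

theorem contDiff_postcomp {G : Type u} [NormedAddCommGroup G] [NormedSpace ℝ G]
    (f : C(E, G)) (hf : ContDiff ℝ ∞ f) : ContDiff ℝ ∞ (fun γ : C(K, E) ↦ f.comp γ) :=
  contDiff_infty.2 fun n ↦ contDiff_nat_postcomp n f (contDiff_infty.1 hf n)

end Superposition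

/-! ### Smooth dependence of solutions of an ordinary differential equation on the data -/

section LocalFlow

variable {E : Type*} [NormedAddCommGroup E] [NormedSpace ℝ E]

/-- The primitive vanishing at `0` of a continuous function on `[-1, 1]`. -/
def primitive [CompleteSpace E] : C(Icc (-1 : ℝ) 1, E) →L[ℝ] C(Icc (-1 : ℝ) 1, E) :=
  LinearMap.mkContinuous
    { toFun := fun γ ↦ ⟨fun s ↦ ∫ r in (0 : ℝ)..s, IccExtend (by norm_num : (-1 : ℝ) ≤ 1) γ r, by
        have : Continuous (IccExtend (by norm_num : (-1 : ℝ) ≤ 1) γ) := γ.continuous.Icc_extend'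
        exact (intervalIntegral.continuous_primitive
          (fun a b ↦ this.intervalIntegrable a b) 0).comp continuous_subtype_val⟩
      map_add' := fun γ η ↦ by
        ext s
        exact intervalIntegral.integral_add
          ((γ.continuous.Icc_extend' (h := by norm_num)).intervalIntegrable _ _)
          ((η.continuous.Icc_extend' (h := by norm_num)).intervalIntegrable _ _)
      map_smul' := fun c γ ↦ by
        ext s
        exact intervalIntegral.integral_smul c _ } 1 (by
    intro γ
    refine (ContinuousMap.norm_le _ (by positivity)).2 fun s ↦ ?_
    refine (intervalIntegral.norm_integral_le_of_norm_le_const (C := ‖γ‖)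
      fun r _ ↦ γ.norm_coe_le_norm _).trans ?_
    rw [mul_comm]
    gcongr
    rw [sub_zero]
    exact abs_le.2 s.2)

/-- The solutions of `γ' = τ f(γ)`, `γ 0 = x` on `[-1, 1]` depend smoothly on `(τ, x)` near
`(0, y)`. -/
theorem exists_contDiffAt_integral_equation [CompleteSpace E] (f : C(E, E))
    (hf : ContDiff ℝ ∞ f) (y : E) :
    ∃ Γ : ℝ × E → C(Icc (-1 : ℝ) 1, E), ContDiffAt ℝ ∞ Γ (0, y) ∧
      Γ (0, y) = ContinuousMap.const _ y ∧
      ∀ᶠ p in 𝓝 (0, y), Γ p = ContinuousMap.const _ p.2 + p.1 • primitive (f.comp (Γ p)) := by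
  let G : (ℝ × E) × C(Icc (-1 : ℝ) 1, E) → C(Icc (-1 : ℝ) 1, E) := fun u ↦
    u.2 - (ContinuousLinearMap.const ℝ _ u.1.2 + u.1.1 • primitive (f.comp u.2))
  let u : (ℝ × E) × C(Icc (-1 : ℝ) 1, E) := ((0, y), ContinuousMap.const _ y)
  have hc : ContDiff ℝ ∞ (fun γ : C(Icc (-1 : ℝ) 1, E) ↦ primitive (f.comp γ)) :=
    primitive.contDiff.comp (contDiff_postcomp f hf)
  have hG : ContDiff ℝ ∞ G := by
    refine contDiff_snd.sub (ContDiff.add ?_ ?_)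
    · exact (ContinuousLinearMap.const (M := E) ℝ (Icc (-1 : ℝ) 1)).contDiff.comp
        (contDiff_snd.comp contDiff_fst)
    · exact (contDiff_fst.comp contDiff_fst).smul (hc.comp contDiff_snd)
  have hGu : G u = 0 := by
    ext s; simp [G, u]
  -- At `τ = 0` the integral term vanishes and `G` is `γ ↦ γ - y`, so its partial derivative in the
  -- curve is the identity.
  have hinv : fderiv ℝ G u ∘L .inr ℝ (ℝ × E) (C(Icc (-1 : ℝ) 1, E)) = .id ℝ _ := by
    have h1 : HasFDerivAt G (fderiv ℝ G u) (((0 : ℝ), y), ContinuousMap.const _ y) :=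
      (hG.differentiable (by simp) u).hasFDerivAt
    have h2 := h1.comp (ContinuousMap.const _ y) (hasFDerivAt_prodMk_right (𝕜 := ℝ) (((0 : ℝ), y))
      (ContinuousMap.const (Icc (-1 : ℝ) 1) y))
    have h3 : (G ∘ fun γ ↦ (((0 : ℝ), y), γ)) = fun γ ↦ γ - ContinuousLinearMap.const ℝ _ y := by
      funext γ; simp [G]
    rw [h3] at h2
    exact h2.unique ((hasFDerivAt_id _).sub_const _)
  have hinv' : (fderiv ℝ G u ∘L .inr ℝ (ℝ × E) (C(Icc (-1 : ℝ) 1, E))).IsInvertible := by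
    rw [hinv]; exact ⟨.refl ℝ _, rfl⟩
  have hat := hG.contDiffAt (x := u)
  refine ⟨hat.implicitFunction (by simp) hinv', hat.contDiffAt_implicitFunction (by simp) hinv',
    hat.implicitFunction_apply_self (by simp) hinv', ?_⟩
  filter_upwards [hat.eventually_apply_implicitFunction (by simp) hinv'] with p hp
  rw [hGu] at hp
  exact sub_eq_zero.1 hp

/-- Local flows of a smooth vector field on a neighbourhood of a point are smooth. -/
theorem exists_contDiffAt_flow [CompleteSpace E] (f : E → E) (hf : ContDiff ℝ ∞ f) (y : E)
    {U : Set E} (hU : U ∈ 𝓝 y) :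
    ∃ φ : ℝ × E → E, ContDiffAt ℝ ∞ φ (0, y) ∧ ∀ᶠ p in 𝓝 ((0 : ℝ), y), ∃ c : ℝ → E,
      c 0 = p.2 ∧ c p.1 = φ p ∧ ∃ a b : ℝ, 0 ∈ Ioo a b ∧ p.1 ∈ Ioo a b ∧
        ∀ s ∈ Ioo a b, c s ∈ U ∧ HasDerivAt c (f (c s)) s := by
  have hle : (-1 : ℝ) ≤ 1 := by norm_num
  obtain ⟨Γ, hΓ, hΓ0, hev⟩ := exists_contDiffAt_integral_equation ⟨f, hf.continuous⟩ hf y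
  have hdouble : ContDiff ℝ ∞ (fun p : ℝ × E ↦ ((2 * p.1, p.2) : ℝ × E)) := by fun_prop
  -- The parameter is doubled and the curve read off at `1 / 2`, so that time `p.1` is interior to
  -- the interval of definition.
  refine ⟨fun p ↦ Γ (2 * p.1, p.2) ⟨1 / 2, by norm_num, by norm_num⟩, ?_, ?_⟩
  · have h1 : ContDiffAt ℝ ∞ Γ ((fun p : ℝ × E ↦ ((2 * p.1, p.2) : ℝ × E)) (0, y)) := by simpa
    exact (ContinuousMap.evalCLM ℝ _).contDiff.contDiffAt.comp _
      (h1.comp ((0 : ℝ), y) hdouble.contDiffAt)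
  obtain ⟨ε, hε, hεU⟩ := Metric.mem_nhds_iff.1 hU
  have hnear : ∀ᶠ p in 𝓝 ((0 : ℝ), y), ∀ s, Γ p s ∈ U := by
    have := hΓ.continuousAt.eventually (Metric.ball_mem_nhds _ (half_pos hε))
    filter_upwards [this] with p hp s
    apply hεU
    have h1 : dist (Γ p s) (Γ (0, y) s) ≤ dist (Γ p) (Γ (0, y)) :=
      ContinuousMap.dist_apply_le_dist s
    rw [hΓ0] at h1 hp
    exact h1.trans_lt (lt_trans hp (half_lt_self hε))
  obtain ⟨V, hV, W, hW, hVW⟩ := mem_nhds_prod_iff.1 (hev.and hnear)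
  obtain ⟨δ, hδ, hδV⟩ := Metric.mem_nhds_iff.1 hV
  -- Rescaling time by `τ` turns a solution of `γ' = τ f(γ)` on `[-1, 1]` into an integral curve of
  -- `f` on `(-|τ|, |τ|)`.
  have key : ∀ τ : ℝ, τ ≠ 0 → |τ| < δ → ∀ x ∈ W,
      (IccExtend hle (Γ (τ, x)) (0 / τ) = x) ∧ ∀ s ∈ Ioo (-|τ|) |τ|,
        IccExtend hle (Γ (τ, x)) (s / τ) ∈ U ∧ HasDerivAt (fun s ↦ IccExtend hle (Γ (τ, x)) (s / τ))
          (f (IccExtend hle (Γ (τ, x)) (s / τ))) s := by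
    intro τ hτ0 hτ x hx
    obtain ⟨h1, h2⟩ := hVW (mk_mem_prod (hδV (by simpa using hτ)) hx)
    have hcont : Continuous (IccExtend hle (ContinuousMap.comp ⟨f, hf.continuous⟩ (Γ (τ, x)))) :=
      (ContinuousMap.continuous _).Icc_extend'
    have hform : ∀ r ∈ Icc (-1 : ℝ) 1, IccExtend hle (Γ (τ, x)) r = x + τ • ∫ r' in (0 : ℝ)..r,
        IccExtend hle (ContinuousMap.comp ⟨f, hf.continuous⟩ (Γ (τ, x))) r' := by
      intro r hr
      rw [IccExtend_of_mem _ _ hr]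
      exact DFunLike.congr_fun h1 ⟨r, hr⟩
    refine ⟨?_, fun s hs ↦ ⟨h2 _, ?_⟩⟩
    · rw [zero_div, hform 0 (by norm_num)]; simp
    have hs' : s / τ ∈ Ioo (-1 : ℝ) 1 := by
      rw [mem_Ioo, ← abs_lt] at hs
      rw [mem_Ioo, ← abs_lt, abs_div]
      exact (div_lt_one (abs_pos.2 hτ0)).2 hs
    have hd : HasDerivAt (fun r ↦ x + τ • ∫ r' in (0 : ℝ)..r,
        IccExtend hle (ContinuousMap.comp ⟨f, hf.continuous⟩ (Γ (τ, x))) r')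
        (τ • IccExtend hle (ContinuousMap.comp ⟨f, hf.continuous⟩ (Γ (τ, x))) (s / τ)) (s / τ) :=
      ((hcont.integral_hasStrictDerivAt 0 (s / τ)).hasDerivAt.const_smul τ).const_add x
    have hd' : HasDerivAt (IccExtend hle (Γ (τ, x)))
        (τ • f (IccExtend hle (Γ (τ, x)) (s / τ))) (s / τ) := by
      refine hd.congr_of_eventuallyEq ?_
      filter_upwards [Ioo_mem_nhds hs'.1 hs'.2] with r hr using hform r (Ioo_subset_Icc_self hr)
    have := hd'.scomp s ((hasDerivAt_id s).div_const τ)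
    rw [smul_smul, one_div, inv_mul_cancel₀ hτ0, one_smul] at this
    exact this
  filter_upwards [prod_mem_nhds (Ioo_mem_nhds (by linarith : -(δ / 2) < 0) (half_pos hδ)) hW]
    with p hp
  have hp1 : |p.1| < δ / 2 := abs_lt.2 hp.1
  -- The rescaling is unavailable at time `0`. There `Γ (0, x)` is constant with value `x`, and any
  -- nonzero admissible parameter, here `δ / 2`, supplies an integral curve.
  by_cases h0 : p.1 = 0
  · obtain ⟨k1, k2⟩ := key (δ / 2) (by positivity)
      (by rw [abs_of_pos (half_pos hδ)]; linarith) p.2 hp.2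
    refine ⟨fun s ↦ IccExtend hle (Γ (δ / 2, p.2)) (s / (δ / 2)), k1, ?_, _, _, ?_, ?_, k2⟩
    · obtain ⟨h1, -⟩ := hVW (mk_mem_prod (hδV (Metric.mem_ball_self hδ)) hp.2)
      simp only [h0] at *
      rw [k1, mul_zero, h1]
      simp
    · simp [hδ.ne']
    · simp [h0, hδ.ne']
  · have h2 : (2 * p.1) ≠ 0 := by simpa
    have h3 : |2 * p.1| = 2 * |p.1| := by simp [abs_mul]
    obtain ⟨k1, k2⟩ := key (2 * p.1) h2 (by rw [h3]; linarith) p.2 hp.2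
    refine ⟨fun s ↦ IccExtend hle (Γ (2 * p.1, p.2)) (s / (2 * p.1)), k1, ?_, _, _, ?_, ?_, k2⟩
    · have : p.1 / (2 * p.1) = 1 / 2 := by field_simp
      simp only [this]
      exact IccExtend_of_mem _ _ _
    · simp [h0]
    · rw [mem_Ioo, ← abs_lt, h3]
      linarith [abs_pos.2 h0]

end LocalFlow

/-! ### Maximal flow of a smooth vector field on a manifold. -/

section ManifoldFlow

variable {E : Type*} [NormedAddCommGroup E] [NormedSpace ℝ E]
  {H : Type*} [TopologicalSpace H] {J : ModelWithCorners ℝ E H}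
  {N : Type*} [TopologicalSpace N] [ChartedSpace H N]
  {W : (y : N) → TangentSpace J y}

/-- A vector field in the chart around `x`. -/
def chartField (W : (y : N) → TangentSpace J y) (x y : N) : E :=
  mfderiv J 𝓘(ℝ, E) (extChartAt J x) y (W y)

/-- Over the source of the chart at `x`, the tangent bundle trivialization around `x` is the
derivative of that chart. -/
theorem contMDiffAt_vectorField_iff [IsManifold J ∞ N] {x y : N} (hy : y ∈ (chartAt H x).source) :
    ContMDiffAt J J.tangent ∞ (fun y ↦ (⟨y, W y⟩ : TangentBundle J N)) y ↔
      ContMDiffAt J 𝓘(ℝ, E) ∞ (chartField W x) y := by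
  have hb : (trivializationAt E (TangentSpace J : N → Type _) x).baseSet = (chartAt H x).source :=
    TangentBundle.trivializationAt_baseSet x
  have h1 := Trivialization.contMDiffAt_section_iff (IB := J) (n := ∞) (s := W)
    (trivializationAt E (TangentSpace J : N → Type _) x) (x₀ := y) (hb ▸ hy)
  refine h1.trans (Filter.EventuallyEq.contMDiffAt_iff ?_)
  filter_upwards [(chartAt H x).open_source.mem_nhds hy] with z hz
  have h2 : (trivializationAt E (TangentSpace J : N → Type _) x ⟨z, W z⟩).2 =
      (trivializationAt E (TangentSpace J : N → Type _) x).continuousLinearMapAt ℝ z (W z) := by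
    rw [Trivialization.continuousLinearMapAt_apply,
      Trivialization.coe_linearMapAt_of_mem _ (hb ▸ hz)]
  exact h2.trans (DFunLike.congr_fun
    (TangentBundle.continuousLinearMapAt_trivializationAt (I := J) hz) (W z))

theorem hasMFDerivAt_extChartAt_symm_comp [J.Boundaryless] [IsManifold J ∞ N] {x : N} {c : ℝ → E}
    {s : ℝ} (hs : c s ∈ (extChartAt J x).target)
    (hc : HasDerivAt c (chartField W x ((extChartAt J x).symm (c s))) s) :
    HasMFDerivAt 𝓘(ℝ, ℝ) J (fun s ↦ (extChartAt J x).symm (c s)) s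
      ((1 : ℝ →L[ℝ] ℝ).smulRight (W ((extChartAt J x).symm (c s)))) := by
  have h1 : MDifferentiableAt 𝓘(ℝ, E) J (extChartAt J x).symm (c s) := by
    have := mdifferentiableWithinAt_extChartAt_symm (I := J) hs
    rwa [J.range_eq_univ, mdifferentiableWithinAt_univ] at this
  have h2 := h1.hasMFDerivAt.comp s hc.hasFDerivAt.hasMFDerivAt
  have h3 := mfderivWithin_extChartAt_symm_comp_mfderiv_extChartAt (I := J) hs
  rw [J.range_eq_univ, mfderivWithin_univ] at h3
  refine h2.congr_mfderiv ?_
  ext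
  exact (congrArg (mfderiv 𝓘(ℝ, E) J (extChartAt J x).symm (c s)) (one_smul ℝ _)).trans
    ((DFunLike.congr_fun h3 (W ((extChartAt J x).symm (c s)))).trans
      (one_smul ℝ (W ((extChartAt J x).symm (c s)))).symm)

theorem exists_contMDiffAt_flow_aux [FiniteDimensional ℝ E] [J.Boundaryless] [IsManifold J ∞ N]
    (hW : ContMDiff J J.tangent ∞ (fun y ↦ (⟨y, W y⟩ : TangentBundle J N))) (x : N) :
    ∃ φ : ℝ × N → N, ContMDiffAt (𝓘(ℝ, ℝ).prod J) J ∞ φ (0, x) ∧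
      ∀ᶠ p in 𝓝 ((0 : ℝ), x), ∃ γ : ℝ → N, ReachesFrom W p.1 p.2 γ ∧ γ p.1 = φ p := by
  have : CompleteSpace E := FiniteDimensional.complete ℝ E
  have hopen : IsOpen (extChartAt J x).target := isOpen_extChartAt_target x
  set y := extChartAt J x x with hy
  have hyt : y ∈ (extChartAt J x).target := mem_extChartAt_target x
  let f₀ : E → E := fun z ↦ chartField W x ((extChartAt J x).symm z)
  have hf₀ : ∀ z ∈ (extChartAt J x).target, ContDiffAt ℝ ∞ f₀ z := by
    intro z hz
    have hs : (extChartAt J x).symm z ∈ (chartAt H x).source := by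
      simpa using (extChartAt J x).map_target hz
    exact (((contMDiffAt_vectorField_iff hs).1 (hW _)).comp z
      ((contMDiffOn_extChartAt_symm x).contMDiffAt (hopen.mem_nhds hz))).contDiffAt
  obtain ⟨r, hr, hrt⟩ := Metric.nhds_basis_closedBall.mem_iff.1 (hopen.mem_nhds hyt)
  let χ : ContDiffBump y := ⟨r / 2, r, half_pos hr, half_lt_self hr⟩
  have hf : ContDiff ℝ ∞ (fun z ↦ χ z • f₀ z) := by
    rw [contDiff_iff_contDiffAt]
    intro z
    by_cases hz : z ∈ (extChartAt J x).target
    · exact χ.contDiff.contDiffAt.smul (hf₀ z hz)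
    · have : z ∉ tsupport χ := fun h ↦ hz (hrt (by rwa [χ.tsupport_eq] at h))
      refine contDiffAt_const (c := (0 : E)) |>.congr_of_eventuallyEq ?_
      filter_upwards [notMem_tsupport_iff_eventuallyEq.1 this] with w hw
      simp [hw]
  -- The cutoff makes the chart field globally smooth. The curves are confined to the ball where `χ`
  -- is `1`, so they are integral curves of the original field.
  obtain ⟨φ, hφ, hev⟩ := exists_contDiffAt_flow _ hf y (Metric.ball_mem_nhds y χ.rIn_pos)
  have hext : ContMDiffAt (𝓘(ℝ, ℝ).prod J) 𝓘(ℝ, ℝ × E) ∞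
      (fun p : ℝ × N ↦ (p.1, extChartAt J x p.2)) (0, x) := by
    have := (contMDiffAt_fst (I := 𝓘(ℝ, ℝ)) (J := J) (p := ((0 : ℝ), x))).prodMk_space
      ((contMDiffAt_extChartAt (n := ∞)).comp ((0 : ℝ), x) contMDiffAt_snd)
    exact this
  refine ⟨fun p ↦ (extChartAt J x).symm (φ (p.1, extChartAt J x p.2)), ?_, ?_⟩
  · have h1 : ContMDiffAt (𝓘(ℝ, ℝ).prod J) 𝓘(ℝ, E) ∞
        (fun p : ℝ × N ↦ φ (p.1, extChartAt J x p.2)) (0, x) :=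
      ContMDiffAt.comp (f := fun p : ℝ × N ↦ (p.1, extChartAt J x p.2)) ((0 : ℝ), x)
        hφ.contMDiffAt hext
    have h0 : φ (0, y) = y := by
      obtain ⟨c, hc0, hc1, -⟩ := hev.self_of_nhds
      exact hc1.symm.trans hc0
    have h2 : ContMDiffAt 𝓘(ℝ, E) J ∞ (extChartAt J x).symm (φ (0, extChartAt J x x)) := by
      rw [← hy, h0]
      exact (contMDiffOn_extChartAt_symm x).contMDiffAt (hopen.mem_nhds hyt)
    exact ContMDiffAt.comp (f := fun p : ℝ × N ↦ φ (p.1, extChartAt J x p.2)) ((0 : ℝ), x) h2 h1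
  · have hsrc : ∀ᶠ p : ℝ × N in 𝓝 ((0 : ℝ), x), p.2 ∈ (extChartAt J x).source :=
      continuousAt_snd.eventually (extChartAt_source_mem_nhds x)
    filter_upwards [hext.continuousAt.eventually hev, hsrc] with p ⟨c, hc0, hc1, a, b, h0, h1, hc⟩ hp
    refine ⟨fun s ↦ (extChartAt J x).symm (c s), ⟨?_, a, b, h0, h1, fun s hs ↦ ?_⟩, ?_⟩
    · simp only at hc0 ⊢
      rw [hc0, (extChartAt J x).left_inv hp]
    · obtain ⟨hcs, hd⟩ := hc s hs
      refine (hasMFDerivAt_extChartAt_symm_comp (hrt (Metric.closedBall_subset_closedBall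
        (half_le_self hr.le) (Metric.ball_subset_closedBall hcs))) ?_).hasMFDerivWithinAt
      rw [χ.one_of_mem_closedBall (Metric.ball_subset_closedBall hcs), one_smul] at hd
      exact hd
    · simp only at hc1 ⊢
      rw [hc1]

variable [T2Space N] [J.Boundaryless] [IsManifold J ∞ N]

/-- Both intervals contain `0` and `t`, hence so does their intersection, where integral curves are
unique. This makes the choice in `flow` immaterial. -/
theorem eq_of_reachesFrom
    (hW : ContMDiff J J.tangent ∞ (fun y ↦ (⟨y, W y⟩ : TangentBundle J N))) {t : ℝ} {x : N}
    {γ γ' : ℝ → N} (h : ReachesFrom W t x γ) (h' : ReachesFrom W t x γ') : γ t = γ' t := by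
  obtain ⟨h0, a, b, ha, hb, hγ⟩ := h
  obtain ⟨h0', a', b', ha', hb', hγ'⟩ := h'
  refine isMIntegralCurveOn_Ioo_eqOn_of_contMDiff_boundaryless (t₀ := 0)
    (a := max a a') (b := min b b') ⟨max_lt ha.1 ha'.1, lt_min ha.2 ha'.2⟩ (hW.of_le (by simp))
    (hγ.mono (Ioo_subset_Ioo (le_max_left _ _) (min_le_left _ _)))
    (hγ'.mono (Ioo_subset_Ioo (le_max_right _ _) (min_le_right _ _)))
    (h0.trans h0'.symm) ⟨max_lt hb.1 hb'.1, lt_min hb.2 hb'.2⟩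

theorem ReachesFrom.flow_eq
    (hW : ContMDiff J J.tangent ∞ (fun y ↦ (⟨y, W y⟩ : TangentBundle J N))) {t : ℝ} {x : N}
    {γ : ℝ → N} (h : ReachesFrom W t x γ) : flow W t x = γ t := by
  have hex : ∃ γ, ReachesFrom W t x γ := ⟨γ, h⟩
  rw [flow, dif_pos hex]
  exact eq_of_reachesFrom hW hex.choose_spec h

omit [T2Space N] [J.Boundaryless] [IsManifold J ∞ N] in
theorem ReachesFrom.mem_flowDomain {t : ℝ} {x : N} {γ : ℝ → N} (h : ReachesFrom W t x γ) :
    (t, x) ∈ flowDomain W := ⟨γ, h⟩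

/-- Shifting `η` by `s` gives an integral curve meeting `γ` at time `s`; the two glue to one on the
union of the intervals. -/
theorem ReachesFrom.flow_mem (hW : ContMDiff J J.tangent ∞ (fun y ↦ (⟨y, W y⟩ : TangentBundle J N)))
    {t s : ℝ} {x y : N} {γ η : ℝ → N} (h : ReachesFrom W s x γ) (hy : γ s = y)
    (h' : ReachesFrom W t y η) : ∃ ζ, ReachesFrom W (s + t) x ζ ∧ ζ (s + t) = η t := by
  obtain ⟨h0, a, b, ha, hb, hγ⟩ := h
  obtain ⟨h0', a', b', ha', hb', hη⟩ := h'
  have hη' : IsMIntegralCurveOn (η ∘ (· + -s)) W (Ioo (a' + s) (b' + s)) := by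
    refine (hη.comp_add (-s)).mono fun r hr ↦ ?_
    exact ⟨by linarith [hr.1], by linarith [hr.2]⟩
  have hmem : s ∈ Ioo a b ∩ Ioo (a' + s) (b' + s) :=
    ⟨hb, by linarith [ha'.1], by linarith [ha'.2]⟩
  have hst : s + t ∈ Ioo (a' + s) (b' + s) := ⟨by linarith [hb'.1], by linarith [hb'.2]⟩
  have hglue : γ s = (η ∘ (· + -s)) s := by simp [h0', hy]
  have hW1 : ContMDiff J J.tangent 1 (fun y ↦ (⟨y, W y⟩ : TangentBundle J N)) :=
    hW.of_le (by simp)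
  classical
  refine ⟨piecewise (Ioo a b) γ (η ∘ (· + -s)),
    ⟨?_, min a (a' + s), max b (b' + s), ?_, ?_, ?_⟩, ?_⟩
  · rw [piecewise_eq_of_mem _ _ _ ha, h0]
  · exact ⟨(min_le_left _ _).trans_lt ha.1, ha.2.trans_le (le_max_left _ _)⟩
  · exact ⟨(min_le_right _ _).trans_lt hst.1, hst.2.trans_le (le_max_right _ _)⟩
  · rw [← Ioo_union_Ioo' (hmem.2.1.trans hmem.1.2) (hmem.1.1.trans hmem.2.2)]
    convert isMIntegralCurveOn_piecewise hW1 hγ hη' hmem hglue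
  · have := eqOn_piecewise_of_isMIntegralCurveOn_Ioo hW1 hγ hη' hmem hglue hst
    convert this using 2
    simp

/-- The group law of the flow, including the statement on its domain. -/
theorem flow_add (hW : ContMDiff J J.tangent ∞ (fun y ↦ (⟨y, W y⟩ : TangentBundle J N)))
    {t s : ℝ} {x : N} (h : (s, x) ∈ flowDomain W) (h' : (t, flow W s x) ∈ flowDomain W) :
    (s + t, x) ∈ flowDomain W ∧ flow W (s + t) x = flow W t (flow W s x) := by
  obtain ⟨γ, hγ⟩ := h
  obtain ⟨η, hη⟩ := h'
  obtain ⟨ζ, hζ, he⟩ := ReachesFrom.flow_mem hW hγ (hγ.flow_eq hW).symm hη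
  exact ⟨hζ.mem_flowDomain, by rw [hζ.flow_eq hW, he, hη.flow_eq hW]⟩

/-- The flow in negative time inverts the flow. -/
theorem flow_neg (hW : ContMDiff J J.tangent ∞ (fun y ↦ (⟨y, W y⟩ : TangentBundle J N)))
    {t : ℝ} {x : N} (h : (t, x) ∈ flowDomain W) :
    (-t, flow W t x) ∈ flowDomain W ∧ flow W (-t) (flow W t x) = x := by
  obtain ⟨γ, hγ⟩ := h
  rw [hγ.flow_eq hW]
  obtain ⟨h0, a, b, ha, hb, hint⟩ := hγ
  have : ReachesFrom W (-t) (γ t) (γ ∘ (· + t)) := by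
    refine ⟨by simp, a - t, b - t, ⟨by linarith [hb.1], by linarith [hb.2]⟩,
      ⟨by linarith [ha.1], by linarith [ha.2]⟩, (hint.comp_add t).mono fun r hr ↦ ?_⟩
    exact ⟨by linarith [hr.1], by linarith [hr.2]⟩
  exact ⟨this.mem_flowDomain, by simp [this.flow_eq hW, h0]⟩

variable [FiniteDimensional ℝ E]

/-- Near time `0` the flow is defined and smooth. -/
theorem flow_near_zero (hW : ContMDiff J J.tangent ∞ (fun y ↦ (⟨y, W y⟩ : TangentBundle J N)))
    (x : N) : flowDomain W ∈ 𝓝 ((0 : ℝ), x) ∧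
      ContMDiffAt (𝓘(ℝ, ℝ).prod J) J ∞ (fun p : ℝ × N ↦ flow W p.1 p.2) (0, x) := by
  obtain ⟨φ, hφ, hev⟩ := exists_contMDiffAt_flow_aux hW x
  refine ⟨?_, hφ.congr_of_eventuallyEq ?_⟩
  · filter_upwards [hev] with p ⟨γ, hγ, _⟩ using ⟨γ, hγ⟩
  · filter_upwards [hev] with p ⟨γ, hγ, he⟩ using by rw [hγ.flow_eq hW, he]

theorem flow_zero (hW : ContMDiff J J.tangent ∞ (fun y ↦ (⟨y, W y⟩ : TangentBundle J N)))
    (x : N) : flow W 0 x = x := by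
  obtain ⟨γ, hγ⟩ := mem_of_mem_nhds (flow_near_zero hW x).1
  exact (hγ.flow_eq hW).trans hγ.1

/-- A property of times which propagates along an integral curve, by a uniform local step,
holds on the whole interval of definition. -/
theorem forall_mem_Ioo_of_local {a b t₀ : ℝ} (ht₀ : t₀ ∈ Ioo a b) {P : ℝ → Prop} (h0 : P t₀)
    (h : ∀ s ∈ Ioo a b, ∃ u ∈ 𝓝 s, ∀ r ∈ u, ∀ r' ∈ u, P r → P r') : ∀ s ∈ Ioo a b, P s := by
  -- The good times form an open and relatively closed subset of a connected interval; both
  -- properties follow since `r` and `r'` are arbitrary in `u`.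
  have hsub : Ioo a b ⊆ {s | s ∈ Ioo a b ∧ P s} := by
    refine isPreconnected_Ioo.subset_of_closure_inter_subset ?_ ⟨t₀, ht₀, ht₀, h0⟩ ?_
    · rw [isOpen_iff_mem_nhds]
      rintro s ⟨hs, hP⟩
      obtain ⟨u, hu, hP'⟩ := h s hs
      filter_upwards [hu, Ioo_mem_nhds hs.1 hs.2] with r hr hr'
      exact ⟨hr', hP' s (mem_of_mem_nhds hu) r hr hP⟩
    · rintro s ⟨hcl, hs⟩
      obtain ⟨u, hu, hP'⟩ := h s hs
      obtain ⟨r, hr, hr'⟩ := mem_closure_iff_nhds.1 hcl u hu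
      exact ⟨hs, hP' r hr s (mem_of_mem_nhds hu) hr'.2⟩
  exact fun s hs ↦ (hsub hs).2

/-- The flow domain is open and the flow is smooth on it. -/
theorem flow_nhds_nat (hW : ContMDiff J J.tangent ∞ (fun y ↦ (⟨y, W y⟩ : TangentBundle J N)))
    (n : ℕ) {p : ℝ × N} (hp : p ∈ flowDomain W) : flowDomain W ∈ 𝓝 p ∧
      ContMDiffAt (𝓘(ℝ, ℝ).prod J) J n (fun p : ℝ × N ↦ flow W p.1 p.2) p := by
  obtain ⟨t, x⟩ := p
  obtain ⟨γ, hγ⟩ := hp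
  obtain ⟨h0, a, b, ha, hb, hint⟩ := id hγ
  refine forall_mem_Ioo_of_local (P := fun t ↦ flowDomain W ∈ 𝓝 (t, x) ∧
    ContMDiffAt (𝓘(ℝ, ℝ).prod J) J n (fun p : ℝ × N ↦ flow W p.1 p.2) (t, x)) ha ?_ ?_ t hb
  · exact ⟨(flow_near_zero hW x).1, (flow_near_zero hW x).2.of_le (by exact_mod_cast le_top)⟩
  intro s hs
  have hflow : ∀ r ∈ Ioo a b, flow W r x = γ r := fun r hr ↦
    ReachesFrom.flow_eq hW ⟨h0, a, b, ha, hr, hint⟩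
  have hcont : ContinuousAt γ s :=
    (hint.continuousWithinAt hs).continuousAt (Ioo_mem_nhds hs.1 hs.2)
  obtain ⟨hd, hsm⟩ := flow_near_zero hW (γ s)
  -- Finite order matters here: being `C^n` at a point extends to a neighbourhood for finite `n`,
  -- while for `∞` the neighbourhood could shrink with the order.
  have hsm' := (contMDiffAt_iff_contMDiffAt_nhds (by simp)).1
    (hsm.of_le (m := n) (by exact_mod_cast le_top))
  have hgood := ((eventually_mem_nhds_iff.2 hd).and hsm')
  have hpair : Tendsto (fun q : ℝ × ℝ ↦ (q.2 - q.1, γ q.1)) (𝓝 (s, s)) (𝓝 (0, γ s)) := by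
    have : ContinuousAt (fun q : ℝ × ℝ ↦ (q.2 - q.1, γ q.1)) (s, s) :=
      (by fun_prop : ContinuousAt (fun q : ℝ × ℝ ↦ q.2 - q.1) (s, s)).prodMk
        (ContinuousAt.comp (x := (s, s)) (g := γ) (f := Prod.fst) hcont continuousAt_fst)
    simpa [ContinuousAt] using this
  have hev := hpair.eventually hgood
  rw [nhds_prod_eq] at hev
  obtain ⟨u, hu, hev⟩ := mem_prod_self_iff.1 hev
  refine ⟨u ∩ Ioo a b, inter_mem hu (Ioo_mem_nhds hs.1 hs.2), ?_⟩
  rintro r ⟨hr, hrI⟩ r' ⟨hr', hrI'⟩ ⟨hPd, hPs⟩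
  obtain ⟨hd1, hs1⟩ := hev (mk_mem_prod hr hr')
  -- The flow for time `p.1` is factored as time `r`, already known to be good, followed by the
  -- short time `p.1 - r`.
  have hmap : ContMDiffAt (𝓘(ℝ, ℝ).prod J) (𝓘(ℝ, ℝ).prod J) n
      (fun p : ℝ × N ↦ (p.1 - r, flow W r p.2)) (r', x) := by
    refine ContMDiffAt.prodMk (ContMDiffAt.sub contMDiffAt_fst contMDiffAt_const) ?_
    exact ContMDiffAt.comp (g := fun p : ℝ × N ↦ flow W p.1 p.2) (f := fun p : ℝ × N ↦ (r, p.2))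
      (r', x) hPs (contMDiffAt_const.prodMk contMDiffAt_snd)
  have hval : (fun p : ℝ × N ↦ (p.1 - r, flow W r p.2)) (r', x) = (r' - r, γ r) := by
    simp [hflow r hrI]
  have hdom : ∀ᶠ p in 𝓝 (r', x), (r, p.2) ∈ flowDomain W ∧
      (p.1 - r, flow W r p.2) ∈ flowDomain W := by
    refine Eventually.and ?_ (hmap.continuousAt.eventually (by rw [hval]; exact hd1))
    have : Tendsto (fun p : ℝ × N ↦ (r, p.2)) (𝓝 (r', x)) (𝓝 (r, x)) :=
      (by fun_prop : Continuous (fun p : ℝ × N ↦ (r, p.2))).tendsto' _ _ rfl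
    exact this.eventually hPd
  refine ⟨?_, ?_⟩
  · filter_upwards [hdom] with p hp
    have := (flow_add hW hp.1 hp.2).1
    rwa [add_sub_cancel] at this
  · have hcomp := ContMDiffAt.comp (g := fun p : ℝ × N ↦ flow W p.1 p.2) 
      (f := fun p : ℝ × N ↦ (p.1 - r, flow W r p.2)) (r', x) (I' := 𝓘(ℝ, ℝ).prod J)
      (hval.symm ▸ hs1) hmap
    refine hcomp.congr_of_eventuallyEq ?_
    filter_upwards [hdom] with p hp
    have := (flow_add hW hp.1 hp.2).2
    rwa [add_sub_cancel] at this

theorem isOpen_flowDomain (hW : ContMDiff J J.tangent ∞ (fun y ↦ (⟨y, W y⟩ : TangentBundle J N))) :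
    IsOpen (flowDomain W) :=
  isOpen_iff_mem_nhds.2 fun _ hp ↦ (flow_nhds_nat hW 0 hp).1

theorem contMDiffAt_flow (hW : ContMDiff J J.tangent ∞ (fun y ↦ (⟨y, W y⟩ : TangentBundle J N)))
    {p : ℝ × N} (hp : p ∈ flowDomain W) :
    ContMDiffAt (𝓘(ℝ, ℝ).prod J) J ∞ (fun p : ℝ × N ↦ flow W p.1 p.2) p :=
  contMDiffAt_infty.2 fun n ↦ (flow_nhds_nat hW n hp).2

end ManifoldFlow

/-! ### Fibre coordinates and locality of derivations. -/

section Hat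

variable {EM : Type*} [NormedAddCommGroup EM] [NormedSpace ℝ EM]
  {H : Type*} [TopologicalSpace H] {I : ModelWithCorners ℝ EM H}
  {M : Type*} [TopologicalSpace M] [ChartedSpace H M]
  {F : Type*} [NormedAddCommGroup F] [NormedSpace ℝ F]
  {V : M → Type*} [TopologicalSpace (TotalSpace F V)] [∀ x, TopologicalSpace (V x)]
  [FiberBundle F V]

-- Points over different base points are separated in the base, points of one fibre inside a
-- trivialization. Uniqueness of integral curves of `hat D` needs this.
omit [NormedSpace ℝ F] in
theorem t2Space_totalSpace [T2Space M] : T2Space (TotalSpace F V) := by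
  refine ⟨fun v w hvw ↦ ?_⟩
  by_cases h : v.1 = w.1
  · set τ := trivializationAt F V v.1
    have hv : v ∈ τ.source := τ.mem_source.2 (mem_baseSet_trivializationAt F V v.1)
    have hw : w ∈ τ.source := τ.mem_source.2 (h ▸ mem_baseSet_trivializationAt F V v.1)
    obtain ⟨u, u', hu, hu', hvu, hwu, hd⟩ := t2_separation (τ.injOn.ne hv hw hvw)
    exact ⟨τ.source ∩ τ ⁻¹' u, τ.source ∩ τ ⁻¹' u',
      τ.toOpenPartialHomeomorph.isOpen_inter_preimage hu,
      τ.toOpenPartialHomeomorph.isOpen_inter_preimage hu', ⟨hv, hvu⟩, ⟨hw, hwu⟩,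
      (hd.preimage τ).mono inter_subset_right inter_subset_right⟩
  · exact separated_by_continuous (FiberBundle.continuous_proj F V) h

variable [∀ x, AddCommGroup (V x)] [∀ x, Module ℝ (V x)] [VectorBundle ℝ F V]

/-- The fibre coordinate in the trivialization around `x₀`, as a linear map on a fibre. -/
def fibreCoord (F : Type*) [NormedAddCommGroup F] [NormedSpace ℝ F]
    {V : M → Type*} [TopologicalSpace (TotalSpace F V)] [∀ x, TopologicalSpace (V x)]
    [FiberBundle F V] [∀ x, AddCommGroup (V x)] [∀ x, Module ℝ (V x)] [VectorBundle ℝ F V]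
    (x₀ x : M) : V x →L[ℝ] F :=
  (trivializationAt F V x₀).continuousLinearMapAt ℝ x

theorem fibreCoord_eq {x₀ : M} {v : TotalSpace F V}
    (hv : v.1 ∈ (trivializationAt F V x₀).baseSet) :
    fibreCoord F x₀ v.1 v.2 = (trivializationAt F V x₀ v).2 := by
  rw [fibreCoord, Trivialization.continuousLinearMapAt_apply,
    Trivialization.coe_linearMapAt_of_mem _ hv]

theorem fibreCoord_injective {x₀ x : M} (hx : x ∈ (trivializationAt F V x₀).baseSet) :
    Function.Injective (fibreCoord F x₀ x : V x → F) :=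
  fun v w h ↦ ((trivializationAt F V x₀).continuousLinearEquivAt ℝ x hx).injective
    ((fibreCoord_eq (v := ⟨x, v⟩) hx).symm.trans (h.trans (fibreCoord_eq (v := ⟨x, w⟩) hx)))

/-- The derivative of a vector-valued function in the direction of a tangent vector. -/
def vecDeriv {G : Type*} [NormedAddCommGroup G] [NormedSpace ℝ G] (I : ModelWithCorners ℝ EM H)
    (f : M → G) (x : M) (u : TangentSpace I x) : G :=
  mfderiv I 𝓘(ℝ, G) f x u

variable [IsManifold I ∞ M] [ContMDiffVectorBundle ∞ F V I]

omit [IsManifold I ∞ M] in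
theorem contMDiffAt_fibreCoord_section {x₀ x : M} (hx : x ∈ (trivializationAt F V x₀).baseSet)
    {s : ∀ x, V x} (hs : ContMDiffAt I (I.prod 𝓘(ℝ, F)) ∞ (fun x ↦ TotalSpace.mk' F x (s x)) x) :
    ContMDiffAt I 𝓘(ℝ, F) ∞ (fun y ↦ fibreCoord F x₀ y (s y)) x := by
  refine (((trivializationAt F V x₀).contMDiffAt_section_iff hx).1 hs).congr_of_eventuallyEq ?_
  filter_upwards [(trivializationAt F V x₀).open_baseSet.mem_nhds hx] with y hy
  exact fibreCoord_eq (v := ⟨y, s y⟩) hy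

variable [FiniteDimensional ℝ EM] [T2Space M]

omit [∀ x, AddCommGroup (V x)] [∀ x, Module ℝ (V x)] [VectorBundle ℝ F V]
  [ContMDiffVectorBundle ∞ F V I] in
/-- A smooth function near `x` agrees near `x` with a global smooth function. -/
theorem exists_global_extension {U : Set M} (hU : IsOpen U) {x : M} (hx : x ∈ U) {f : M → ℝ}
    (hf : ContMDiffOn I 𝓘(ℝ) ∞ f U) : ∃ g : C^∞⟮I, M; 𝓘(ℝ), ℝ⟯, g =ᶠ[𝓝 x] f := by
  obtain ⟨χ, hχ, -⟩ := (SmoothBumpFunction.nhds_basis_support (I := I) (hU.mem_nhds hx)).mem_iff.1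
    (hU.mem_nhds hx)
  refine ⟨⟨fun y ↦ χ y • f y, contMDiff_of_tsupport fun y hy ↦ ?_⟩, ?_⟩
  · have hyU : y ∈ U := hχ (closure_mono (Function.support_smul_subset_left _ _) hy)
    exact χ.contMDiffAt.smul (hf.contMDiffAt (hU.mem_nhds hyU))
  · filter_upwards [χ.eventuallyEq_one] with y hy
    show χ y • f y = f y
    rw [hy]; simp

/-- There are global sections with locally constant fibre coordinate. -/
theorem exists_section_fibreCoord_eq (x₀ : M) (c : F) :
    ∃ e : Cₛ^∞⟮I; F, V⟯, ∀ᶠ y in 𝓝 x₀, fibreCoord F x₀ y (e y) = c := by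
  set τ := trivializationAt F V x₀
  have hx := mem_baseSet_trivializationAt F V x₀
  have hs : ContMDiffOn I (I.prod 𝓘(ℝ, F)) ∞ (fun y ↦ TotalSpace.mk' F y (τ.symm y c))
      τ.baseSet := by
    rw [τ.contMDiffOn_section_baseSet_iff]
    refine (contMDiffOn_const (c := c)).congr fun y hy ↦ ?_
    rw [τ.apply_mk_symm hy]
  obtain ⟨χ, hχ, -⟩ := (SmoothBumpFunction.nhds_basis_support (I := I)
    (τ.open_baseSet.mem_nhds hx)).mem_iff.1 (τ.open_baseSet.mem_nhds hx)
  refine ⟨⟨_, ContMDiffOn.smul_section_of_tsupport χ.contMDiff.contMDiffOn τ.open_baseSet hχ hs⟩, ?_⟩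
  filter_upwards [χ.eventuallyEq_one, τ.open_baseSet.mem_nhds hx] with y hy hy'
  have h1 := fibreCoord_eq (v := ⟨y, τ.symm y c⟩) hy'
  rw [τ.apply_mk_symm hy'] at h1
  show fibreCoord F x₀ y (χ y • τ.symm y c) = c
  rw [hy, map_smul, h1]
  simp

variable {X : Cₛ^∞⟮I; EM, (TangentSpace I : M → Type _)⟯}

omit [ContMDiffVectorBundle ∞ F V I] in
/-- A derivation is a local operator. -/
theorem LinearDerivation.apply_eq_zero (D : LinearDerivation F V X) {e : Cₛ^∞⟮I; F, V⟯} {x : M}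
    (he : ∀ᶠ y in 𝓝 x, e y = 0) : D.toLinearMap e x = 0 := by
  obtain ⟨U, hUe, hU, hx⟩ := mem_nhds_iff.1 he
  obtain ⟨χ, hχ, -⟩ := (SmoothBumpFunction.nhds_basis_support (I := I) (hU.mem_nhds hx)).mem_iff.1
    (hU.mem_nhds hx)
  let g : C^∞⟮I, M; 𝓘(ℝ), ℝ⟯ := ⟨χ, χ.contMDiff⟩
  have hg : ∀ y, g y = χ y := fun _ ↦ rfl
  -- The bump function is supported where `e` vanishes, so the Leibniz rule at `x` reads `0 = D e
  -- x`.
  have h0 : smulSection g e = 0 := by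
    ext y
    rw [smulSection_apply, hg]
    by_cases hy : χ y = 0
    · rw [hy, zero_smul]; rfl
    · rw [hUe (hχ (subset_tsupport _ hy)), smul_zero]; rfl
  have h1 := D.leibniz g e x
  have h2 : D.toFun (smulSection g e) = 0 := by
    rw [h0]; exact D.toLinearMap.map_zero
  rw [h2, hUe hx, smul_zero, zero_add, hg, χ.eq_one, one_smul] at h1
  exact h1.symm

omit [VectorBundle ℝ F V] [IsManifold I ∞ M] [ContMDiffVectorBundle ∞ F V I]
  [FiniteDimensional ℝ EM] [T2Space M] in
theorem sum_section_apply [VectorBundle ℝ F V] {ι : Type*} (t : Finset ι)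
    (s : ι → Cₛ^∞⟮I; F, V⟯) (x : M) : (∑ i ∈ t, s i) x = ∑ i ∈ t, s i x := by
  have := congrFun (map_sum (ContMDiffSection.coeAddHom I F ∞ V) s t) x
  rw [Finset.sum_apply] at this
  exact this

/-- The fibre component of `hat`, in the trivialization around `x₀`, computed from a section. -/
def fibrePart (D : LinearDerivation F V X) (x₀ : M) (e : Cₛ^∞⟮I; F, V⟯) (y : M) : F :=
  vecDeriv I (fun z ↦ fibreCoord F x₀ z (e z)) y (X y) -
    fibreCoord F x₀ y (D.toLinearMap e y)

/-- The fibre component of `hat` is a smooth linear function of the value of the section. -/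
theorem fibrePart_eq [FiniteDimensional ℝ F] (D : LinearDerivation F V X) (x₀ : M) :
    ∃ (ι : Type) (_ : Fintype ι) (b : Module.Basis ι ℝ F) (e' : ι → Cₛ^∞⟮I; F, V⟯),
      ∀ᶠ y in 𝓝 x₀, ∀ e : Cₛ^∞⟮I; F, V⟯, fibrePart D x₀ e y =
        -∑ i, b.repr (fibreCoord F x₀ y (e y)) i • fibreCoord F x₀ y (D.toLinearMap (e' i) y) := by
  let b := Module.finBasis ℝ F
  choose e' he' using fun i ↦ exists_section_fibreCoord_eq (I := I) (V := V) x₀ (b i)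
  refine ⟨_, inferInstance, b, e', ?_⟩
  have hall : ∀ᶠ y in 𝓝 x₀, ∀ i, fibreCoord F x₀ y (e' i y) = b i := eventually_all.2 he'
  have hbase := (trivializationAt F V x₀).open_baseSet
  filter_upwards [eventually_eventually_nhds.2 hall,
    hbase.mem_nhds (mem_baseSet_trivializationAt F V x₀)] with y hy hyb e
  have hsm : ContMDiffOn I 𝓘(ℝ, F) ∞ (fun z ↦ fibreCoord F x₀ z (e z))
      (trivializationAt F V x₀).baseSet := fun z hz ↦
    (contMDiffAt_fibreCoord_section hz (e.contMDiff z)).contMDiffWithinAt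
  let L : Fin (Module.finrank ℝ F) → F →L[ℝ] ℝ := fun i ↦ (b.coord i).toContinuousLinearMap
  -- The coordinates of `e` are only locally smooth functions; global functions with the same germs
  -- at `y` make the Leibniz rule applicable.
  have hex : ∀ i, ∃ g : C^∞⟮I, M; 𝓘(ℝ), ℝ⟯, g =ᶠ[𝓝 y] fun z ↦ L i (fibreCoord F x₀ z (e z)) :=
    fun i ↦ exists_global_extension hbase hyb ((L i).contMDiff.comp_contMDiffOn hsm)
  choose g hg using hex
  have hvan : D.toLinearMap (e - ∑ i, smulSection (g i) (e' i)) y = 0 := by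
    refine D.apply_eq_zero ?_
    filter_upwards [eventually_all.2 hg, hy, hbase.mem_nhds hyb] with z hz hz' hzb
    refine fibreCoord_injective hzb ?_
    have h1 : (e - ∑ i, smulSection (g i) (e' i)) z = e z - ∑ i, g i z • e' i z := by
      rw [ContMDiffSection.coe_sub, Pi.sub_apply]
      rw [sum_section_apply]; rfl
    rw [h1, map_sub, map_sum, map_zero, sub_eq_zero]
    simp_rw [map_smul, hz', hz]
    exact (b.sum_repr _).symm
  have hDe : D.toLinearMap e y =
      ∑ i, (dirDeriv I (g i) y (X y) • e' i y + g i y • D.toLinearMap (e' i) y) := by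
    rw [map_sub, ContMDiffSection.coe_sub, Pi.sub_apply, sub_eq_zero] at hvan
    rw [hvan, map_sum, sum_section_apply]
    exact Finset.sum_congr rfl fun i _ ↦ D.leibniz (g i) (e' i) y
  have hmd : MDifferentiableAt I 𝓘(ℝ, F) (fun z ↦ fibreCoord F x₀ z (e z)) y :=
    (hsm.contMDiffAt (hbase.mem_nhds hyb)).mdifferentiableAt (by simp)
  have hdir : ∀ i, dirDeriv I (g i) y (X y) =
      b.repr (vecDeriv I (fun z ↦ fibreCoord F x₀ z (e z)) y (X y)) i := by
    intro i
    have h1 := (L i).hasFDerivAt.hasMFDerivAt.comp y hmd.hasMFDerivAt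
    have h2 := (h1.congr_of_eventuallyEq (hg i)).mfderiv
    exact congrArg (fun A : EM →L[ℝ] ℝ ↦ A (X y)) h2
  have hgy : ∀ i, g i y = b.repr (fibreCoord F x₀ y (e y)) i := fun i ↦ (hg i).self_of_nhds
  -- The terms `X(g i) • b i` add up to the derivative of the coordinate of `e` along `X` and cancel
  -- it, so only the value of `e` at `y` survives.
  rw [fibrePart, hDe, map_sum]
  simp_rw [map_add, map_smul, hy.self_of_nhds, Finset.sum_add_distrib, hdir, hgy, b.sum_repr]
  abel

end Hat

/-! ### Chart expression and smoothness of the linear vector field. -/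

section HatSmooth

variable {EM : Type*} [NormedAddCommGroup EM] [NormedSpace ℝ EM] [FiniteDimensional ℝ EM]
  {H : Type*} [TopologicalSpace H] {I : ModelWithCorners ℝ EM H}
  {M : Type*} [TopologicalSpace M] [ChartedSpace H M] [T2Space M] [IsManifold I ∞ M]
  {F : Type*} [NormedAddCommGroup F] [NormedSpace ℝ F]
  {V : M → Type*} [TopologicalSpace (TotalSpace F V)] [∀ x, TopologicalSpace (V x)]
  [FiberBundle F V] [∀ x, AddCommGroup (V x)] [∀ x, Module ℝ (V x)] [VectorBundle ℝ F V]
  [ContMDiffVectorBundle ∞ F V I]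
  {X : Cₛ^∞⟮I; EM, (TangentSpace I : M → Type _)⟯}

/-- The vector `T_m e (X(m)) + d/dt|_{t=0} (e(m) - t (D e)(m))` for a given section `e`. -/
def hatOf (D : LinearDerivation F V X) (e : Cₛ^∞⟮I; F, V⟯) (v : TotalSpace F V) :
    TangentSpace (I.prod 𝓘(ℝ, F)) v :=
  let horizontal : TangentSpace (I.prod 𝓘(ℝ, F)) v :=
    mfderiv I (I.prod 𝓘(ℝ, F)) (fun x ↦ TotalSpace.mk' F x (e x)) v.1 (X v.1)
  let vertical : TangentSpace (I.prod 𝓘(ℝ, F)) v :=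
    mfderiv 𝓘(ℝ) (I.prod 𝓘(ℝ, F)) (verticalCurve F v.1 (e v.1) (D.toLinearMap e v.1)) 0 (1 : ℝ)
  horizontal + vertical

theorem exists_hat_eq_hatOf_choice (D : LinearDerivation F V X) (v : TotalSpace F V) :
    ∃ e : Cₛ^∞⟮I; F, V⟯, e v.1 = v.2 ∧ hat D v = hatOf D e v :=
  ⟨_, (exists_section (I := I) v).choose_spec, rfl⟩

/-- The derivative of a map between manifolds as a linear map between the model spaces. -/
def modelDeriv {E' H' N : Type*} [NormedAddCommGroup E'] [NormedSpace ℝ E']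
    [TopologicalSpace H'] [TopologicalSpace N] [ChartedSpace H' N]
    (I : ModelWithCorners ℝ EM H) (J : ModelWithCorners ℝ E' H') (f : M → N) (x : M) :
    EM →L[ℝ] E' :=
  mfderiv I J f x

omit [FiniteDimensional ℝ EM] [T2Space M] in
/-- The chain rule for the sum defining `hatOf`, for maps to another manifold. -/
theorem mfderiv_hatOf {E' H' N : Type*} [NormedAddCommGroup E'] [NormedSpace ℝ E']
    [TopologicalSpace H'] {J : ModelWithCorners ℝ E' H'} [TopologicalSpace N] [ChartedSpace H' N]
    (D : LinearDerivation F V X) {e : Cₛ^∞⟮I; F, V⟯} {v : TotalSpace F V} (hev : e v.1 = v.2)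
    {g : TotalSpace F V → N} (hgv : MDifferentiableAt (I.prod 𝓘(ℝ, F)) J g v) :
    modelDeriv (I.prod 𝓘(ℝ, F)) J g v (hatOf D e v) =
      modelDeriv I J (fun x ↦ g (TotalSpace.mk' F x (e x))) v.1 (X v.1) +
        modelDeriv 𝓘(ℝ) J (fun t ↦ g (verticalCurve F v.1 (e v.1) (D.toLinearMap e v.1) t)) 0
          1 := by
  have hv : TotalSpace.mk' F v.1 (e v.1) = v := by rw [hev]
  have hv' : verticalCurve F v.1 (e v.1) (D.toLinearMap e v.1) 0 = v := by
    simp [verticalCurve, hev]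
  have hs : MDifferentiableAt I (I.prod 𝓘(ℝ, F)) (fun x ↦ TotalSpace.mk' F x (e x)) v.1 :=
    e.mdifferentiableAt
  have hc : MDifferentiableAt 𝓘(ℝ) (I.prod 𝓘(ℝ, F))
      (verticalCurve F v.1 (e v.1) (D.toLinearMap e v.1)) 0 :=
    (contMDiff_verticalCurve (I := I) v.1 _ _).mdifferentiableAt (by simp)
  have h1 := HasMFDerivAt.comp v.1 (hv.symm ▸ hgv).hasMFDerivAt hs.hasMFDerivAt
  have h2 := HasMFDerivAt.comp (0 : ℝ) (hv'.symm ▸ hgv).hasMFDerivAt hc.hasMFDerivAt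
  have key : ∀ (p : TotalSpace F V) (_ : p = v) (a : EM × F),
      modelDeriv (I.prod 𝓘(ℝ, F)) J g p a = modelDeriv (I.prod 𝓘(ℝ, F)) J g v a := by
    rintro p rfl a; rfl
  have e1 : modelDeriv I J (fun x ↦ g (TotalSpace.mk' F x (e x))) v.1 (X v.1) = _ :=
    (congrArg (fun A : EM →L[ℝ] E' ↦ A (X v.1)) h1.mfderiv).trans (key _ hv _)
  have e2 : modelDeriv 𝓘(ℝ) J (fun t ↦ g (verticalCurve F v.1 (e v.1) (D.toLinearMap e v.1) t)) 0
      1 = _ :=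
    (congrArg (fun A : ℝ →L[ℝ] E' ↦ A 1) h2.mfderiv).trans (key _ hv' _)
  rw [e1, e2]
  exact map_add (mfderiv (I.prod 𝓘(ℝ, F)) J g v) _ _

omit [FiniteDimensional ℝ EM] [T2Space M] [IsManifold I ∞ M] [ContMDiffVectorBundle ∞ F V I] in
theorem extChartAt_totalSpace {v₀ w : TotalSpace F V}
    (hw : w.1 ∈ (trivializationAt F V v₀.1).baseSet) :
    extChartAt (I.prod 𝓘(ℝ, F)) v₀ w = (extChartAt I v₀.1 w.1, fibreCoord F v₀.1 w.1 w.2) := by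
  rw [fibreCoord_eq hw, FiberBundle.extChartAt]
  have : (trivializationAt F V v₀.1 w).1 = w.1 := Trivialization.coe_fst' _ hw
  simp only [PartialEquiv.coe_trans, Function.comp_apply, PartialEquiv.prod_coe, PartialEquiv.refl_coe, id]
  exact Prod.ext (congrArg (extChartAt I v₀.1) this) rfl

omit [NormedSpace ℝ F] [∀ x, AddCommGroup (V x)] [∀ x, Module ℝ (V x)] [VectorBundle ℝ F V]
  [T2Space M] in
theorem mem_chart_source_totalSpace {v₀ w : TotalSpace F V} :
    w ∈ (chartAt (ModelProd H F) v₀).source ↔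
      w.1 ∈ (trivializationAt F V v₀.1).baseSet ∧ w.1 ∈ (chartAt H v₀.1).source := by
  rw [FiberBundle.chartedSpace_chartAt]
  simp only [OpenPartialHomeomorph.trans_source, Trivialization.mem_source, mem_inter_iff,
    mem_preimage, OpenPartialHomeomorph.prod_source, OpenPartialHomeomorph.refl_source, mem_prod,
    mem_univ, and_true]
  refine and_congr_right fun h ↦ ?_
  have : (trivializationAt F V v₀.1 w).1 = w.1 := Trivialization.coe_fst' _ h
  exact this ▸ Iff.rfl

omit [FiniteDimensional ℝ EM] [T2Space M] in
/-- The expression of `hatOf` in a chart of the total space. -/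
theorem mfderiv_extChartAt_hatOf (D : LinearDerivation F V X) {e : Cₛ^∞⟮I; F, V⟯}
    {v₀ v : TotalSpace F V} (hev : e v.1 = v.2) (hv : v ∈ (chartAt (ModelProd H F) v₀).source) :
    modelDeriv (I.prod 𝓘(ℝ, F)) 𝓘(ℝ, EM × F) (extChartAt (I.prod 𝓘(ℝ, F)) v₀) v
      (hatOf D e v) = (chartField X v₀.1 v.1, fibrePart D v₀.1 e v.1) := by
  obtain ⟨hb, hc⟩ := mem_chart_source_totalSpace.1 hv
  have hbase := (trivializationAt F V v₀.1).open_baseSet.mem_nhds hb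
  rw [mfderiv_hatOf D hev (mdifferentiableAt_extChartAt hv)]
  have hm1 : HasMFDerivAt I 𝓘(ℝ, EM) (extChartAt I v₀.1) v.1 _ :=
    (mdifferentiableAt_extChartAt hc).hasMFDerivAt
  have hm2 : HasMFDerivAt I 𝓘(ℝ, F) (fun z ↦ fibreCoord F v₀.1 z (e z)) v.1 _ :=
    ((contMDiffAt_fibreCoord_section hb (e.contMDiff _)).mdifferentiableAt
      (by simp)).hasMFDerivAt
  have hm : HasMFDerivAt I 𝓘(ℝ, EM × F)
      (fun z ↦ (extChartAt I v₀.1 z, fibreCoord F v₀.1 z (e z))) v.1 _ :=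
    ⟨hm1.1.prodMk hm2.1, hm1.2.prodMk hm2.2⟩
  have h1 := hm.congr_of_eventuallyEq
    (f₁ := fun x ↦ extChartAt (I.prod 𝓘(ℝ, F)) v₀ (TotalSpace.mk' F x (e x))) (by
      filter_upwards [hbase] with z hz
      exact extChartAt_totalSpace (w := TotalSpace.mk' F z (e z)) hz)
  have h2 : (fun t ↦ extChartAt (I.prod 𝓘(ℝ, F)) v₀
      (verticalCurve F v.1 (e v.1) (D.toLinearMap e v.1) t)) = fun t : ℝ ↦
      (extChartAt I v₀.1 v.1, fibreCoord F v₀.1 v.1 (e v.1) -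
        t • fibreCoord F v₀.1 v.1 (D.toLinearMap e v.1)) := by
    funext t
    rw [extChartAt_totalSpace (w := verticalCurve F v.1 _ _ t) hb, ← map_smul, ← map_sub]
    rfl
  have h3 : HasDerivAt (fun t : ℝ ↦ (extChartAt I v₀.1 v.1, fibreCoord F v₀.1 v.1 (e v.1) -
        t • fibreCoord F v₀.1 v.1 (D.toLinearMap e v.1)))
      ((0 : EM), -(fibreCoord F v₀.1 v.1 (D.toLinearMap e v.1))) 0 := by
    refine (hasDerivAt_const _ _).prodMk ?_
    simpa using ((hasDerivAt_id (0 : ℝ)).smul_const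
      (fibreCoord F v₀.1 v.1 (D.toLinearMap e v.1))).const_sub (fibreCoord F v₀.1 v.1 (e v.1))
  have e1 : modelDeriv I 𝓘(ℝ, EM × F) (fun x ↦ extChartAt (I.prod 𝓘(ℝ, F)) v₀
      (TotalSpace.mk' F x (e x))) v.1 (X v.1) =
      (chartField X v₀.1 v.1, vecDeriv I (fun z ↦ fibreCoord F v₀.1 z (e z)) v.1 (X v.1)) :=
    congrArg (fun A : EM →L[ℝ] EM × F ↦ A (X v.1)) h1.mfderiv
  have e2 : modelDeriv 𝓘(ℝ) 𝓘(ℝ, EM × F) (fun t ↦ extChartAt (I.prod 𝓘(ℝ, F)) v₀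
      (verticalCurve F v.1 (e v.1) (D.toLinearMap e v.1) t)) 0 1 =
      ((0 : EM), -(fibreCoord F v₀.1 v.1 (D.toLinearMap e v.1))) := by
    rw [h2, modelDeriv, h3.hasFDerivAt.hasMFDerivAt.mfderiv]
    exact one_smul ℝ _
  rw [e1, e2, fibrePart, Prod.mk_add_mk, add_zero, sub_eq_add_neg]

omit [FiniteDimensional ℝ EM] [T2Space M] [IsManifold I ∞ M] in
theorem contMDiffAt_fibreCoord {x₀ : M} {v₀ : TotalSpace F V}
    (hb : v₀.1 ∈ (trivializationAt F V x₀).baseSet) :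
    ContMDiffAt (I.prod 𝓘(ℝ, F)) 𝓘(ℝ, F) ∞
      (fun v : TotalSpace F V ↦ fibreCoord F x₀ v.1 v.2) v₀ := by
  have hproj : ContMDiffAt (I.prod 𝓘(ℝ, F)) I ∞ (fun v : TotalSpace F V ↦ v.1) v₀ :=
    contMDiffAt_proj V
  have h1 : ContMDiffAt (I.prod 𝓘(ℝ, F)) 𝓘(ℝ, F) ∞
      (fun v : TotalSpace F V ↦ (trivializationAt F V x₀ v).2) v₀ :=
    ((trivializationAt F V x₀).contMDiffAt_iff (f := id) (x₀ := v₀)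
      ((trivializationAt F V x₀).mem_source.2 hb)).1 contMDiffAt_id |>.2
  refine h1.congr_of_eventuallyEq ?_
  filter_upwards [hproj.continuousAt.eventually
    ((trivializationAt F V x₀).open_baseSet.mem_nhds hb)] with v hv using fibreCoord_eq hv

variable [FiniteDimensional ℝ F]

/-- `hat` may be computed from any section with the given value. -/
theorem hat_eq_hatOf (D : LinearDerivation F V X) {e : Cₛ^∞⟮I; F, V⟯} {v : TotalSpace F V}
    (hev : e v.1 = v.2) : hat D v = hatOf D e v := by
  obtain ⟨e₀, he₀, h⟩ := exists_hat_eq_hatOf_choice (I := I) D v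
  rw [h]
  have hv : v ∈ (chartAt (ModelProd H F) v).source := mem_chart_source _ v
  -- The chart derivative is injective, so two candidates for `hat D v` may be compared in the
  -- chart, where only the value of the section enters.
  have hinj := (isInvertible_mfderiv_extChartAt (I := I.prod 𝓘(ℝ, F))
    (mem_extChartAt_source (I := I.prod 𝓘(ℝ, F)) v)).injective
  refine hinj ?_
  obtain ⟨ι, _, b, e', hf⟩ := fibrePart_eq D v.1
  have h1 := mfderiv_extChartAt_hatOf D he₀ hv
  have h2 := mfderiv_extChartAt_hatOf D hev hv
  rw [hf.self_of_nhds, he₀] at h1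
  rw [hf.self_of_nhds, hev] at h2
  exact h1.trans h2.symm

/-- `hat` is a smooth vector field. -/
theorem contMDiff_hat (D : LinearDerivation F V X) :
    ContMDiff (I.prod 𝓘(ℝ, F)) (I.prod 𝓘(ℝ, F)).tangent ∞
      (fun v ↦ (⟨v, hat D v⟩ : TangentBundle (I.prod 𝓘(ℝ, F)) (TotalSpace F V))) := by
  intro v₀
  have hv₀ : v₀ ∈ (chartAt (ModelProd H F) v₀).source := mem_chart_source _ v₀
  obtain ⟨hb, hc⟩ := mem_chart_source_totalSpace.1 hv₀
  rw [contMDiffAt_vectorField_iff hv₀]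
  obtain ⟨ι, _, b, e', hf⟩ := fibrePart_eq D v₀.1
  have hproj : ContMDiffAt (I.prod 𝓘(ℝ, F)) I ∞ (fun v : TotalSpace F V ↦ v.1) v₀ :=
    contMDiffAt_proj V
  have hX : ContMDiffAt (I.prod 𝓘(ℝ, F)) 𝓘(ℝ, EM) ∞
      (fun v : TotalSpace F V ↦ chartField X v₀.1 v.1) v₀ :=
    ((contMDiffAt_vectorField_iff hc).1 (X.contMDiff v₀.1)).comp v₀ hproj
  have hcoord := contMDiffAt_fibreCoord (I := I) hb
  have hsum : ContMDiffAt (I.prod 𝓘(ℝ, F)) 𝓘(ℝ, F) ∞ (fun v : TotalSpace F V ↦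
      -∑ i, b.repr (fibreCoord F v₀.1 v.1 v.2) i •
        fibreCoord F v₀.1 v.1 (D.toLinearMap (e' i) v.1)) v₀ := by
    refine (contMDiffAt_finsetSum fun i _ ↦ ?_).neg
    have h1 : ContMDiffAt (I.prod 𝓘(ℝ, F)) 𝓘(ℝ) ∞
        (fun v : TotalSpace F V ↦ b.repr (fibreCoord F v₀.1 v.1 v.2) i) v₀ :=
      (b.coord i).toContinuousLinearMap.contMDiff.contMDiffAt.comp v₀ hcoord
    have h2 : ContMDiffAt (I.prod 𝓘(ℝ, F)) 𝓘(ℝ, F) ∞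
        (fun v : TotalSpace F V ↦ fibreCoord F v₀.1 v.1 (D.toLinearMap (e' i) v.1)) v₀ :=
      (contMDiffAt_fibreCoord_section hb ((D.toLinearMap (e' i)).contMDiff _)).comp v₀ hproj
    exact h1.smul h2
  refine (hX.prodMk_space hsum).congr_of_eventuallyEq ?_
  filter_upwards [(chartAt (ModelProd H F) v₀).open_source.mem_nhds hv₀,
    hproj.continuousAt.eventually hf] with v hv hfv
  -- The section `e` varies with `v` in no controlled way; this is harmless because `hfv` depends on
  -- it only through `e v.1 = v.2`.
  obtain ⟨e, he, h⟩ := exists_hat_eq_hatOf_choice (I := I) D v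
  rw [chartField, h]
  refine (mfderiv_extChartAt_hatOf D he hv).trans ?_
  rw [hfv e, he]

end HatSmooth

/-! ### Related vector fields and their flows. -/

section Related

variable {E : Type*} [NormedAddCommGroup E] [NormedSpace ℝ E]
  {H : Type*} [TopologicalSpace H] {J : ModelWithCorners ℝ E H}
  {N : Type*} [TopologicalSpace N] [ChartedSpace H N]
  {W : (y : N) → TangentSpace J y}
  {E' : Type*} [NormedAddCommGroup E'] [NormedSpace ℝ E']
  {H' : Type*} [TopologicalSpace H'] {J' : ModelWithCorners ℝ E' H'}
  {N' : Type*} [TopologicalSpace N'] [ChartedSpace H' N']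
  {W' : (y : N') → TangentSpace J' y}

/-- A map relating two vector fields maps integral curves to integral curves. -/
theorem ReachesFrom.map {g : N → N'} (hg : MDifferentiable J J' g)
    (h : ∀ v, modelDeriv J J' g v (W v) = W' (g v)) {t : ℝ} {x : N} {γ : ℝ → N}
    (hγ : ReachesFrom W t x γ) : ReachesFrom W' t (g x) (g ∘ γ) := by
  obtain ⟨h0, a, b, ha, hb, hint⟩ := hγ
  refine ⟨congrArg g h0, a, b, ha, hb, fun s hs ↦ ?_⟩
  refine ((hg (γ s)).hasMFDerivAt.comp_hasMFDerivWithinAt s (hint s hs)).congr_mfderiv ?_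
  ext
  have h1 : modelDeriv J J' g (γ s) ((1 : ℝ) • W (γ s)) = (1 : ℝ) • W' (g (γ s)) := by
    rw [one_smul, one_smul, h]
  exact h1

variable [T2Space N] [J.Boundaryless] [IsManifold J ∞ N]

theorem flow_map [T2Space N'] [J'.Boundaryless] [IsManifold J' ∞ N']
    (hW : ContMDiff J J.tangent ∞ (fun y ↦ (⟨y, W y⟩ : TangentBundle J N)))
    (hW' : ContMDiff J' J'.tangent ∞ (fun y ↦ (⟨y, W' y⟩ : TangentBundle J' N')))
    {g : N → N'} (hg : MDifferentiable J J' g)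
    (h : ∀ v, modelDeriv J J' g v (W v) = W' (g v)) {t : ℝ} {x : N}
    (hx : (t, x) ∈ flowDomain W) :
    (t, g x) ∈ flowDomain W' ∧ flow W' t (g x) = g (flow W t x) := by
  obtain ⟨γ, hγ⟩ := hx
  have := hγ.map hg h
  exact ⟨this.mem_flowDomain, by rw [this.flow_eq hW', hγ.flow_eq hW]; rfl⟩

/-- The derivative along the flow at time `0`. -/
theorem hasDerivAt_comp_flow [FiniteDimensional ℝ E]
    (hW : ContMDiff J J.tangent ∞ (fun y ↦ (⟨y, W y⟩ : TangentBundle J N)))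
    {G : Type*} [NormedAddCommGroup G] [NormedSpace ℝ G] {g : N → G} {x : N}
    (hg : MDifferentiableAt J 𝓘(ℝ, G) g x) :
    HasDerivAt (fun t ↦ g (flow W t x)) (modelDeriv J 𝓘(ℝ, G) g x (W x)) 0 := by
  obtain ⟨γ, hγ⟩ := mem_of_mem_nhds (flow_near_zero hW x).1
  obtain ⟨h0, a, b, ha, -, hint⟩ := hγ
  simp only at h0
  subst h0
  have h1 := (hint 0 ha).hasMFDerivAt (Ioo_mem_nhds ha.1 ha.2)
  let w : E := W (γ 0)
  let L : ℝ →L[ℝ] G := modelDeriv J 𝓘(ℝ, G) g (γ 0) ∘L (1 : ℝ →L[ℝ] ℝ).smulRight w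
  have h2 : HasFDerivAt (g ∘ γ) L 0 :=
    hasMFDerivAt_iff_hasFDerivAt.1 (hg.hasMFDerivAt.comp 0 h1)
  have h4 : HasDerivAt (g ∘ γ) (modelDeriv J 𝓘(ℝ, G) g (γ 0) w) 0 :=
    h2.hasDerivAt.congr_deriv (congrArg (modelDeriv J 𝓘(ℝ, G) g (γ 0)) (one_smul ℝ w))
  refine h4.congr_of_eventuallyEq ?_
  filter_upwards [Ioo_mem_nhds ha.1 ha.2] with t ht
  have : ReachesFrom W t (γ 0) γ := ⟨rfl, a, b, ha, ht, hint⟩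
  rw [this.flow_eq hW]; rfl

end Related

/-! ### The flow of the linear vector field covers the flow of the symbol. -/

section HatFlow

variable {EM : Type*} [NormedAddCommGroup EM] [NormedSpace ℝ EM] [FiniteDimensional ℝ EM]
  {H : Type*} [TopologicalSpace H] {I : ModelWithCorners ℝ EM H}
  {M : Type*} [TopologicalSpace M] [ChartedSpace H M] [T2Space M] [IsManifold I ∞ M]
  {F : Type*} [NormedAddCommGroup F] [NormedSpace ℝ F] [FiniteDimensional ℝ F]
  {V : M → Type*} [TopologicalSpace (TotalSpace F V)] [∀ x, TopologicalSpace (V x)]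
  [FiberBundle F V] [∀ x, AddCommGroup (V x)] [∀ x, Module ℝ (V x)] [VectorBundle ℝ F V]
  [ContMDiffVectorBundle ∞ F V I]
  {X : Cₛ^∞⟮I; EM, (TangentSpace I : M → Type _)⟯}

omit [FiniteDimensional ℝ F] in
/-- `hat` is projectable to the symbol. -/
theorem modelDeriv_proj_hat (D : LinearDerivation F V X) (v : TotalSpace F V) :
    modelDeriv (I.prod 𝓘(ℝ, F)) I (fun w : TotalSpace F V ↦ w.1) v (hat D v) = X v.1 := by
  obtain ⟨e, he, h⟩ := exists_hat_eq_hatOf_choice (I := I) D v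
  rw [h, mfderiv_hatOf D he ((contMDiff_proj (IB := I) (n := ∞) V v).mdifferentiableAt (by simp))]
  have h1 : modelDeriv I I (fun x : M ↦ (TotalSpace.mk' F x (e x)).1) v.1 = .id ℝ EM :=
    mfderiv_id
  have h2 : modelDeriv 𝓘(ℝ) I (fun t ↦ (verticalCurve F v.1 (e v.1) (D.toLinearMap e v.1) t).1) 0
      = 0 := mfderiv_const
  rw [h1, h2]
  exact add_zero _

/-- A section in the kernel of the derivation relates the symbol to `hat`. -/
theorem modelDeriv_section (D : LinearDerivation F V X) {e : Cₛ^∞⟮I; F, V⟯}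
    (he : D.toLinearMap e = 0) (x : M) :
    modelDeriv I (I.prod 𝓘(ℝ, F)) (fun x ↦ TotalSpace.mk' F x (e x)) x (X x) =
      hat D (TotalSpace.mk' F x (e x)) := by
  rw [hat_eq_hatOf D (e := e) (v := TotalSpace.mk' F x (e x)) rfl]
  have h1 : verticalCurve F x (e x) (D.toLinearMap e x) = fun _ ↦ TotalSpace.mk' F x (e x) := by
    funext t
    have : D.toLinearMap e x = 0 := by rw [he]; rfl
    simp [verticalCurve, this]
  have h2 : modelDeriv 𝓘(ℝ) (I.prod 𝓘(ℝ, F)) (verticalCurve F x (e x) (D.toLinearMap e x)) 0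
      = 0 := by
    rw [h1]; exact mfderiv_const
  have h3 : modelDeriv I (I.prod 𝓘(ℝ, F)) (fun x ↦ TotalSpace.mk' F x (e x)) x (X x) +
      modelDeriv 𝓘(ℝ) (I.prod 𝓘(ℝ, F)) (verticalCurve F x (e x) (D.toLinearMap e x)) 0 1 =
      modelDeriv I (I.prod 𝓘(ℝ, F)) (fun x ↦ TotalSpace.mk' F x (e x)) x (X x) := by
    rw [h2]; exact add_zero _
  exact h3.symm

/-- Multiplication by a scalar in the fibres. -/
def fibreScale (c : ℝ) (v : TotalSpace F V) : TotalSpace F V := ⟨v.1, c • v.2⟩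

omit [FiniteDimensional ℝ EM] [T2Space M] [IsManifold I ∞ M] [FiniteDimensional ℝ F] in
theorem contMDiff_fibreScale (c : ℝ) :
    ContMDiff (I.prod 𝓘(ℝ, F)) (I.prod 𝓘(ℝ, F)) ∞ (fibreScale (F := F) (V := V) c) := by
  intro v
  rw [contMDiffAt_totalSpace]
  refine ⟨contMDiffAt_proj V, ?_⟩
  have hb : v.1 ∈ (trivializationAt F V v.1).baseSet := mem_baseSet_trivializationAt F V v.1
  have h1 : ContMDiffAt (I.prod 𝓘(ℝ, F)) 𝓘(ℝ, F) ∞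
      (fun w : TotalSpace F V ↦ c • fibreCoord F v.1 w.1 w.2) v := by
    have hc : ContMDiffAt (I.prod 𝓘(ℝ, F)) 𝓘(ℝ) ∞ (fun _ : TotalSpace F V ↦ c) v :=
      contMDiffAt_const
    have hf : ContMDiffAt (I.prod 𝓘(ℝ, F)) 𝓘(ℝ, F) ∞
        (fun w : TotalSpace F V ↦ fibreCoord F v.1 w.1 w.2) v := contMDiffAt_fibreCoord hb
    exact hc.smul hf
  refine h1.congr_of_eventuallyEq ?_
  filter_upwards [(FiberBundle.continuous_proj F V).continuousAt.eventually
    ((trivializationAt F V v.1).open_baseSet.mem_nhds hb)] with w hw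
  rw [← map_smul]
  exact (fibreCoord_eq (v := fibreScale c w) hw).symm

/-- `hat` is a linear vector field. -/
theorem modelDeriv_fibreScale_hat (D : LinearDerivation F V X) (c : ℝ) (v : TotalSpace F V) :
    modelDeriv (I.prod 𝓘(ℝ, F)) (I.prod 𝓘(ℝ, F)) (fibreScale c) v (hat D v) =
      hat D (fibreScale c v) := by
  obtain ⟨e, he, h⟩ := exists_hat_eq_hatOf_choice (I := I) D v
  rw [h, mfderiv_hatOf D he ((contMDiff_fibreScale (I := I) c v).mdifferentiableAt (by simp)),
    hat_eq_hatOf D (e := c • e) (v := fibreScale c v)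
      (show c • e v.1 = c • v.2 by rw [he])]
  have h1 : (fun t ↦ fibreScale c (verticalCurve F v.1 (e v.1) (D.toLinearMap e v.1) t)) =
      verticalCurve F v.1 ((c • e) v.1) (D.toLinearMap (c • e) v.1) := by
    funext t
    have : D.toLinearMap (c • e) v.1 = c • D.toLinearMap e v.1 := by rw [map_smul]; rfl
    rw [this]
    show (⟨v.1, c • (e v.1 - t • D.toLinearMap e v.1)⟩ : TotalSpace F V) =
      ⟨v.1, c • e v.1 - t • c • D.toLinearMap e v.1⟩
    rw [smul_sub, smul_comm]
  rw [h1]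
  rfl

variable [I.Boundaryless]

/-- Near every point of the base, all flow lines of `hat` have a common time of existence. -/
theorem exists_uniform_time (D : LinearDerivation F V X) (x₀ : M) :
    ∃ δ > 0, ∃ U ∈ 𝓝 x₀, ∀ t : ℝ, |t| < δ → ∀ v : TotalSpace F V, v.1 ∈ U →
      (t, v) ∈ flowDomain (hat D) := by
  have : T2Space (TotalSpace F V) := t2Space_totalSpace
  have hnear := (flow_near_zero (contMDiff_hat D) (TotalSpace.mk' F x₀ (0 : V x₀))).1
  obtain ⟨A, hA, B, hB, hAB⟩ := mem_nhds_prod_iff.1 hnear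
  obtain ⟨δ, hδ, hδA⟩ := Metric.mem_nhds_iff.1 hA
  obtain ⟨B', hB', hB'o, hB'0⟩ := mem_nhds_iff.1 hB
  have hzero : Continuous (fun x ↦ TotalSpace.mk' F x (0 : V x)) :=
    (contMDiff_zeroSection (IB := I) (n := ∞) ℝ V).continuous
  refine ⟨δ, hδ, _, hzero.continuousAt.preimage_mem_nhds (hB'o.mem_nhds hB'0), fun t ht v hv ↦ ?_⟩
  have hcurve : ContinuousAt (fun c : ℝ ↦ fibreScale c v) 0 := by
    have := (contMDiff_verticalCurve (I := I) (F := F) v.1 0 (-v.2)).continuous.continuousAt (x := 0)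
    have he : verticalCurve F v.1 0 (-v.2) = fun c : ℝ ↦ fibreScale c v := by
      funext c; simp [verticalCurve, fibreScale]
    rwa [he] at this
  have hev : ∀ᶠ c : ℝ in 𝓝 0, fibreScale c v ∈ B' := by
    refine hcurve.eventually (hB'o.mem_nhds ?_)
    have : fibreScale (0 : ℝ) v = TotalSpace.mk' F v.1 (0 : V v.1) := by simp [fibreScale]
    exact mem_of_eq_of_mem this hv
  -- A nonzero `c` brings `v` close to the zero section, where time `t` is available; scaling by
  -- `c⁻¹` preserves integral curves and returns to `v`.
  obtain ⟨c, hc, hc0⟩ := ((hev.filter_mono nhdsWithin_le_nhds).and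
    (self_mem_nhdsWithin (s := {0}ᶜ) (a := (0 : ℝ)))).exists
  have hdom : (t, fibreScale c v) ∈ flowDomain (hat D) :=
    hAB (mk_mem_prod (hδA (by simpa using ht)) (hB' hc))
  have hmap := (flow_map (contMDiff_hat D) (contMDiff_hat D)
    ((contMDiff_fibreScale (I := I) c⁻¹).mdifferentiable (by simp))
    (modelDeriv_fibreScale_hat D c⁻¹) hdom).1
  have hv' : fibreScale c⁻¹ (fibreScale c v) = v := by
    show (⟨v.1, c⁻¹ • c • v.2⟩ : TotalSpace F V) = v
    rw [inv_smul_smul₀ hc0]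
  rwa [hv'] at hmap

theorem flow_hat_proj (D : LinearDerivation F V X) {t : ℝ} {v : TotalSpace F V}
    (hv : (t, v) ∈ flowDomain (hat D)) : (flow (hat D) t v).1 = flow X t v.1 := by
  have : T2Space (TotalSpace F V) := t2Space_totalSpace
  exact (flow_map (contMDiff_hat D) X.contMDiff
    ((contMDiff_proj (IB := I) (n := ∞) V).mdifferentiable (by simp))
    (modelDeriv_proj_hat D) hv).2.symm

/-- The flow of `hat` exists as long as the flow of the symbol. -/
theorem mem_flowDomain_hat (D : LinearDerivation F V X) {t : ℝ} {v : TotalSpace F V}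
    (h : (t, v.1) ∈ flowDomain X) : (t, v) ∈ flowDomain (hat D) := by
  have : T2Space (TotalSpace F V) := t2Space_totalSpace
  obtain ⟨γ, h0, a, b, ha, hb, hint⟩ := h
  refine forall_mem_Ioo_of_local (P := fun t ↦ (t, v) ∈ flowDomain (hat D)) ha
    (mem_of_mem_nhds (flow_near_zero (contMDiff_hat D) v).1) (fun s hs ↦ ?_) t hb
  obtain ⟨δ, hδ, U, hU, hδU⟩ := exists_uniform_time D (γ s)
  have hcont : ContinuousAt γ s :=
    (hint.continuousWithinAt hs).continuousAt (Ioo_mem_nhds hs.1 hs.2)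
  refine ⟨_, inter_mem (Metric.ball_mem_nhds s (half_pos hδ))
    (inter_mem (hcont.preimage_mem_nhds hU) (Ioo_mem_nhds hs.1 hs.2)), ?_⟩
  rintro r ⟨hr, hrU, hrI⟩ r' ⟨hr', -, -⟩ hP
  have hbase : (flow (hat D) r v).1 = γ r := by
    rw [flow_hat_proj D hP]
    exact ReachesFrom.flow_eq X.contMDiff ⟨h0, a, b, ha, hrI, hint⟩
  have hlt : |r' - r| < δ := by
    rw [← Real.dist_eq]
    have h1 := dist_triangle_right r' r s
    rw [Metric.mem_ball] at hr hr'
    linarith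
  have := (flow_add (contMDiff_hat D) hP (hδU (r' - r) hlt _ (by rw [hbase]; exact hrU))).1
  rwa [add_sub_cancel] at this

end HatFlow

/-! ### Pullback of sections, its derivative, and invariance. -/

section Pull

variable {EM : Type*} [NormedAddCommGroup EM] [NormedSpace ℝ EM] [FiniteDimensional ℝ EM]
  {H : Type*} [TopologicalSpace H] {I : ModelWithCorners ℝ EM H} [I.Boundaryless]
  {M : Type*} [TopologicalSpace M] [ChartedSpace H M] [T2Space M] [IsManifold I ∞ M]
  {F : Type*} [NormedAddCommGroup F] [NormedSpace ℝ F] [FiniteDimensional ℝ F]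
  {V : M → Type*} [TopologicalSpace (TotalSpace F V)] [∀ x, TopologicalSpace (V x)]
  [FiberBundle F V] [∀ x, AddCommGroup (V x)] [∀ x, Module ℝ (V x)] [VectorBundle ℝ F V]
  [ContMDiffVectorBundle ∞ F V I]
  {X : Cₛ^∞⟮I; EM, (TangentSpace I : M → Type _)⟯}

theorem isOpen_timeDomain (t : ℝ) : IsOpen (timeDomain X t) :=
  (isOpen_flowDomain X.contMDiff).preimage (by fun_prop : Continuous fun x : M ↦ (t, x))

theorem mem_flowDomain_hat_of_mem_timeDomain (D : LinearDerivation F V X)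
    (e : Cₛ^∞⟮I; F, V⟯) {t : ℝ} {x : M} (hx : x ∈ timeDomain X t) :
    (-t, TotalSpace.mk' F (flow X t x) (e (flow X t x))) ∈ flowDomain (hat D) :=
  mem_flowDomain_hat D (flow_neg X.contMDiff hx).1

/-- Since `Φ` covers `φ`, the point lies over `φ_{-t} (φ_t x) = x`, so the default value in `pull`
never occurs on `M_t`. -/
theorem mk_pull (D : LinearDerivation F V X) (e : Cₛ^∞⟮I; F, V⟯) {t : ℝ} {x : M}
    (hx : x ∈ timeDomain X t) :
    TotalSpace.mk' F x (pull D t e x) =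
      flow (hat D) (-t) (TotalSpace.mk' F (flow X t x) (e (flow X t x))) := by
  have h : (flow (hat D) (-t) (TotalSpace.mk' F (flow X t x) (e (flow X t x)))).1 = x :=
    (flow_hat_proj D (mem_flowDomain_hat_of_mem_timeDomain D e hx)).trans
      (flow_neg X.contMDiff hx).2
  have key : ∀ (w : TotalSpace F V) (hw : w.1 = x), TotalSpace.mk' F x (hw ▸ w.2) = w := by
    rintro w rfl; rfl
  rw [pull, dif_pos h]
  exact key _ h

theorem contMDiffOn_pull (D : LinearDerivation F V X) (e : Cₛ^∞⟮I; F, V⟯) (t : ℝ) :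
    ContMDiffOn I (I.prod 𝓘(ℝ, F)) ∞ (fun x ↦ TotalSpace.mk' F x (pull D t e x))
      (timeDomain X t) := by
  have : T2Space (TotalSpace F V) := t2Space_totalSpace
  refine ContMDiffOn.congr (f := fun x ↦
    flow (hat D) (-t) (TotalSpace.mk' F (flow X t x) (e (flow X t x)))) (fun x hx ↦ ?_)
    fun x hx ↦ mk_pull D e hx
  have h1 : ContMDiffAt I I ∞ (fun x ↦ flow X t x) x :=
    ContMDiffAt.comp (g := fun p : ℝ × M ↦ flow X p.1 p.2) (f := fun x ↦ (t, x)) x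
      (contMDiffAt_flow X.contMDiff hx) (contMDiffAt_const.prodMk contMDiffAt_id)
  have h2 : ContMDiffAt I (I.prod 𝓘(ℝ, F)) ∞
      (fun x ↦ TotalSpace.mk' F (flow X t x) (e (flow X t x))) x :=
    ContMDiffAt.comp (g := fun y ↦ TotalSpace.mk' F y (e y)) x (e.contMDiff (flow X t x)) h1
  exact (ContMDiffAt.comp (g := fun p : ℝ × TotalSpace F V ↦ flow (hat D) p.1 p.2)
    (f := fun x ↦ (-t, TotalSpace.mk' F (flow X t x) (e (flow X t x)))) x
    (contMDiffAt_flow (contMDiff_hat D) (mem_flowDomain_hat_of_mem_timeDomain D e hx))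
    (contMDiffAt_const.prodMk h2)).contMDiffWithinAt

theorem eventually_mem_timeDomain (x : M) : ∀ᶠ t in 𝓝 (0 : ℝ), x ∈ timeDomain X t := by
  have h : ContinuousAt (fun t : ℝ ↦ (t, x)) 0 := by fun_prop
  exact h.eventually (flow_near_zero X.contMDiff x).1

theorem pull_zero (D : LinearDerivation F V X) (e : Cₛ^∞⟮I; F, V⟯) (x : M) :
    pull D 0 e x = e x := by
  have : T2Space (TotalSpace F V) := t2Space_totalSpace
  have h := mk_pull D e (eventually_mem_timeDomain (X := X) x).self_of_nhds
  rw [neg_zero, flow_zero (contMDiff_hat D), flow_zero X.contMDiff] at h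
  exact TotalSpace.mk_inj.1 h

/-- The derivative of the pullback at time `0`, in the trivialization around the base point. -/
theorem hasDerivAt_fibreCoord_pull (D : LinearDerivation F V X) (e : Cₛ^∞⟮I; F, V⟯) (x : M) :
    HasDerivAt (fun t : ℝ ↦ fibreCoord F x x (pull D t e x))
      (fibreCoord F x x (D.toLinearMap e x)) 0 := by
  have : T2Space (TotalSpace F V) := t2Space_totalSpace
  set v : TotalSpace F V := TotalSpace.mk' F x (e x) with hvdef
  let C : TotalSpace F V → F := fun w ↦ fibreCoord F x w.1 w.2
  have hb : v.1 ∈ (trivializationAt F V x).baseSet := mem_baseSet_trivializationAt F V x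
  have hC : ContMDiffAt (I.prod 𝓘(ℝ, F)) 𝓘(ℝ, F) ∞ C v := contMDiffAt_fibreCoord hb
  -- Separating the two occurrences of time reduces the derivative to two partial derivatives, one
  -- for each flow.
  let h : ℝ × ℝ → F := fun p ↦
    C (flow (hat D) p.1 (TotalSpace.mk' F (flow X p.2 x) (e (flow X p.2 x))))
  have hsm : ContMDiffAt 𝓘(ℝ, ℝ × ℝ) 𝓘(ℝ, F) ∞ h (0, 0) := by
    have h1 : ContMDiffAt 𝓘(ℝ, ℝ × ℝ) I ∞ (fun p : ℝ × ℝ ↦ flow X p.2 x) (0, 0) :=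
      ContMDiffAt.comp (g := fun p : ℝ × M ↦ flow X p.1 p.2) (f := fun p : ℝ × ℝ ↦ (p.2, x)) (0, 0)
        (flow_near_zero X.contMDiff x).2
        (contDiff_snd.contMDiff.contMDiffAt.prodMk contMDiffAt_const)
    have h2 : ContMDiffAt 𝓘(ℝ, ℝ × ℝ) (I.prod 𝓘(ℝ, F)) ∞
        (fun p : ℝ × ℝ ↦ TotalSpace.mk' F (flow X p.2 x) (e (flow X p.2 x))) (0, 0) :=
      ContMDiffAt.comp (g := fun y ↦ TotalSpace.mk' F y (e y)) (0, 0) (e.contMDiff _) h1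
    have hval : TotalSpace.mk' F (flow X 0 x) (e (flow X 0 x)) = v := by
      rw [flow_zero X.contMDiff]
    have h3 : ContMDiffAt 𝓘(ℝ, ℝ × ℝ) (I.prod 𝓘(ℝ, F)) ∞ (fun p : ℝ × ℝ ↦
        flow (hat D) p.1 (TotalSpace.mk' F (flow X p.2 x) (e (flow X p.2 x)))) (0, 0) := by
      refine ContMDiffAt.comp (g := fun p : ℝ × TotalSpace F V ↦ flow (hat D) p.1 p.2)
        (f := fun p : ℝ × ℝ ↦ (p.1, TotalSpace.mk' F (flow X p.2 x) (e (flow X p.2 x)))) (0, 0)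
        ?_ (contDiff_fst.contMDiff.contMDiffAt.prodMk h2)
      exact (flow_near_zero (contMDiff_hat D) _).2
    refine ContMDiffAt.comp (g := C) (0, 0) ?_ h3
    show ContMDiffAt _ _ _ C (flow (hat D) 0 (TotalSpace.mk' F (flow X 0 x) (e (flow X 0 x))))
    rw [flow_zero (contMDiff_hat D), hval]
    exact hC
  obtain ⟨L, hL⟩ := hsm.contDiffAt.differentiableAt (by simp)
  have hCe : MDifferentiableAt I 𝓘(ℝ, F) (fun y ↦ C (TotalSpace.mk' F y (e y))) x :=
    (contMDiffAt_fibreCoord_section hb (e.contMDiff x)).mdifferentiableAt (by simp)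
  have hs : HasDerivAt (fun s : ℝ ↦ h (s, 0)) (fibrePart D x e x) 0 := by
    have h1 := hasDerivAt_comp_flow (contMDiff_hat D) (hC.mdifferentiableAt (by simp))
    have h2 : (fun s : ℝ ↦ h (s, 0)) = fun s ↦ C (flow (hat D) s v) := by
      funext s
      simp only [h]
      rw [flow_zero X.contMDiff]
    rw [h2]
    refine h1.congr_deriv ?_
    rw [hat_eq_hatOf D (e := e) (v := v) rfl, mfderiv_hatOf D (e := e) (v := v) rfl
      (hC.mdifferentiableAt (by simp)), fibrePart, sub_eq_add_neg]
    congr 1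
    have h3 : HasDerivAt (fun t : ℝ ↦ C (verticalCurve F v.1 (e v.1) (D.toLinearMap e v.1) t))
        (-(fibreCoord F x x (D.toLinearMap e x))) 0 := by
      have h4 : (fun t : ℝ ↦ C (verticalCurve F v.1 (e v.1) (D.toLinearMap e v.1) t)) =
          fun t ↦ fibreCoord F x x (e x) - t • fibreCoord F x x (D.toLinearMap e x) := by
        funext t
        rw [← map_smul, ← map_sub]
        rfl
      rw [h4]
      simpa using ((hasDerivAt_id (0 : ℝ)).smul_const
        (fibreCoord F x x (D.toLinearMap e x))).const_sub (fibreCoord F x x (e x))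
    rw [modelDeriv, h3.hasFDerivAt.hasMFDerivAt.mfderiv]
    exact one_smul ℝ _
  have ht : HasDerivAt (fun t : ℝ ↦ h (0, t))
      (vecDeriv I (fun y ↦ fibreCoord F x y (e y)) x (X x)) 0 := by
    have h2 : (fun t : ℝ ↦ h (0, t)) = fun t ↦
        (fun y ↦ C (TotalSpace.mk' F y (e y))) (flow X t x) := by
      funext t
      simp only [h]
      rw [flow_zero (contMDiff_hat D)]
    rw [h2]
    exact hasDerivAt_comp_flow X.contMDiff hCe
  have hcomp (g : ℝ → ℝ × ℝ) (g' : ℝ × ℝ) (hg : HasDerivAt g g' 0) (h0 : g 0 = (0, 0)) :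
      HasDerivAt (fun t ↦ h (g t)) (L g') 0 := by
    have hLg : HasFDerivAt h L (g 0) := h0 ▸ hL
    exact hLg.comp_hasDerivAt (0 : ℝ) hg
  have hs' : L (1, 0) = fibrePart D x e x :=
    (hcomp (fun s ↦ (s, 0)) (1, 0) ((hasDerivAt_id (0 : ℝ)).prodMk
      (hasDerivAt_const (0 : ℝ) (0 : ℝ))) rfl).unique hs
  have ht' : L (0, 1) = vecDeriv I (fun y ↦ fibreCoord F x y (e y)) x (X x) :=
    (hcomp (fun t ↦ (0, t)) (0, 1) ((hasDerivAt_const (0 : ℝ) (0 : ℝ)).prodMk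
      (hasDerivAt_id (0 : ℝ))) rfl).unique ht
  have hdiag : HasDerivAt (fun t : ℝ ↦ h (-t, t)) (L (-1, 1)) 0 :=
    hcomp (fun t ↦ (-t, t)) (-1, 1) ((hasDerivAt_neg (0 : ℝ)).prodMk
      (hasDerivAt_id (0 : ℝ))) (by simp)
  -- The derivative of the coordinate of `e` along `X` occurs in both partial derivatives and
  -- cancels.
  have hval : L (-1, 1) = fibreCoord F x x (D.toLinearMap e x) := by
    have : ((-1, 1) : ℝ × ℝ) = -(1, 0) + (0, 1) := by simp
    rw [this, map_add, map_neg, hs', ht', fibrePart]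
    abel
  rw [hval] at hdiag
  refine hdiag.congr_of_eventuallyEq ?_
  filter_upwards [eventually_mem_timeDomain (X := X) x] with t htx
  exact congrArg C (mk_pull D e htx)

/-- The fibres carry a topology but no norm, so the derivative is a limit of slopes, transported
from `F` by the inverse of the trivialization. -/
theorem tendsto_slope_pull (D : LinearDerivation F V X) (e : Cₛ^∞⟮I; F, V⟯) (x : M) :
    Tendsto (slope (fun t : ℝ ↦ pull D t e x) 0) (𝓝[≠] 0) (𝓝 (D.toLinearMap e x)) := by
  have hx := mem_baseSet_trivializationAt F V x
  let A := (trivializationAt F V x).continuousLinearEquivAt ℝ x hx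
  have hA : ∀ w : V x, A w = fibreCoord F x x w := fun w ↦
    (fibreCoord_eq (v := ⟨x, w⟩) hx).symm
  have h1 := hasDerivAt_iff_tendsto_slope.1 (hasDerivAt_fibreCoord_pull D e x)
  have h2 := (A.symm.continuous.tendsto _).comp h1
  rw [← hA, A.symm_apply_apply] at h2
  refine h2.congr fun t ↦ ?_
  simp only [Function.comp_apply, slope_def_module, ← hA, ← map_sub, ← map_smul,
    A.symm_apply_apply]

/-- When `D e = 0`, the section maps integral curves of `X` to those of `hat D`, so `Φ_{-t} (e (φ_t
x)) = e (φ_{-t} (φ_t x)) = e x`. -/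
theorem pull_eq_self (D : LinearDerivation F V X) {e : Cₛ^∞⟮I; F, V⟯} (he : D.toLinearMap e = 0)
    {t : ℝ} {x : M} (hx : x ∈ timeDomain X t) : pull D t e x = e x := by
  have : T2Space (TotalSpace F V) := t2Space_totalSpace
  have h := mk_pull D e hx
  obtain ⟨h1, h2⟩ := flow_neg X.contMDiff hx
  have h3 := (flow_map X.contMDiff (contMDiff_hat D) (fun y ↦ e.mdifferentiableAt)
    (modelDeriv_section D he) h1).2
  rw [h2] at h3
  exact TotalSpace.mk_inj.1 (h.trans h3)

/-- For the converse, `x` lies in `M_t` for all small `t`, so invariance makes the slopes eventually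
zero, and limits in the Hausdorff fibre are unique. -/
theorem pull_eq_self_iff (D : LinearDerivation F V X) (e : Cₛ^∞⟮I; F, V⟯) :
    (∀ t : ℝ, ∀ x ∈ timeDomain X t, pull D t e x = e x) ↔ D.toLinearMap e = 0 := by
  refine ⟨fun h ↦ ?_, fun he t x hx ↦ pull_eq_self D he hx⟩
  ext x
  have : T2Space (V x) := FiberBundle.t2Space F V x
  refine tendsto_nhds_unique (tendsto_slope_pull D e x) ?_
  refine tendsto_const_nhds.congr' ?_
  filter_upwards [(eventually_mem_timeDomain (X := X) x).filter_mono nhdsWithin_le_nhds] with t ht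
  simp only [slope_def_module, h t x ht, pull_zero, sub_self, smul_zero]
  rfl

end Pull

end BundleFlow

end

theorem corollary3p3
    {EM : Type*} [NormedAddCommGroup EM] [NormedSpace ℝ EM] [FiniteDimensional ℝ EM]
    {H : Type*} [TopologicalSpace H] {I : ModelWithCorners ℝ EM H} [I.Boundaryless]
    {M : Type*} [TopologicalSpace M] [ChartedSpace H M] [T2Space M] [IsManifold I ∞ M]
    {F : Type*} [NormedAddCommGroup F] [NormedSpace ℝ F] [FiniteDimensional ℝ F]
    {V : M → Type*} [TopologicalSpace (TotalSpace F V)] [∀ x, TopologicalSpace (V x)]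
    [FiberBundle F V] [∀ x, AddCommGroup (V x)] [∀ x, Module ℝ (V x)] [VectorBundle ℝ F V]
    [ContMDiffVectorBundle ∞ F V I]
    (X : Cₛ^∞⟮I; EM, (TangentSpace I : M → Type _)⟯)
    (D : BundleFlow.LinearDerivation F V X) :
    -- `Φ_t^⋆ e` is a well-defined smooth section over the open set `M_t`
    (∀ t : ℝ, IsOpen (BundleFlow.timeDomain X t)) ∧
    (∀ (e : Cₛ^∞⟮I; F, V⟯) (t : ℝ),
      (∀ x ∈ BundleFlow.timeDomain X t,
        (-t, TotalSpace.mk' F (BundleFlow.flow X t x) (e (BundleFlow.flow X t x))) ∈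
            BundleFlow.flowDomain (BundleFlow.hat D) ∧
          TotalSpace.mk' F x (BundleFlow.pull D t e x) =
            BundleFlow.flow (BundleFlow.hat D) (-t)
              (TotalSpace.mk' F (BundleFlow.flow X t x) (e (BundleFlow.flow X t x)))) ∧
      ContMDiffOn I (I.prod 𝓘(ℝ, F)) ∞
        (fun x ↦ TotalSpace.mk' F x (BundleFlow.pull D t e x)) (BundleFlow.timeDomain X t)) ∧
    -- `D e` is the pointwise derivative of `Φ_t^⋆ e` at `t = 0`
    (∀ (e : Cₛ^∞⟮I; F, V⟯) (x : M),
      Tendsto (slope (fun t : ℝ ↦ BundleFlow.pull D t e x) 0) (𝓝[≠] 0)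
        (𝓝 (D.toLinearMap e x))) ∧
    -- `e` is invariant under the flow if and only if `D e = 0`
    (∀ e : Cₛ^∞⟮I; F, V⟯,
      (∀ t : ℝ, ∀ x ∈ BundleFlow.timeDomain X t, BundleFlow.pull D t e x = e x) ↔
        D.toLinearMap e = 0) := by
  exact ⟨fun t ↦ BundleFlow.isOpen_timeDomain t,
    fun e t ↦ ⟨fun x hx ↦ ⟨BundleFlow.mem_flowDomain_hat_of_mem_timeDomain D e hx,
      BundleFlow.mk_pull D e hx⟩, BundleFlow.contMDiffOn_pull D e t⟩,
    fun e x ↦ BundleFlow.tendsto_slope_pull D e x, fun e ↦ BundleFlow.pull_eq_self_iff D e⟩
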